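/- An instance of the offline knapsack problem under explorable uncertainty consists of items $1,\dots,n$, a capacity $B\in\mathbb N$, weights $w_i\in\mathbb N$ with $w_i\le B$, profits $p_i\in\mathbb R_{\ge 0}$, and for every item an uncertainty interval $I_i\ni p_i$ that is either an open interval $(L_i,U_i)$ or trivial, $I_i=\{p_i\}$, in which case $L_i=U_i=p_i$. Let $\mathcal I_T$ be the set of trivial items. A packing is a set $P$ of items with $\sum_{i\in P}w_i\le B$; put $p(P)=\sum_{i\in P}p_i$ and let $p^*$ be the maximum of $p(P)$ over all packings. For a set $Q$ of items (a query set) let $U_P(Q)=\sum_{i\in P\setminus Q}U_i+\sum_{i\in P\cap Q}p_i$. The query set $Q$ is feasible if (1) some packing $P\subseteq Q\cup\mathcal I_T$ has $p(P)=p^*$ and (2) $U_P(Q)\le p^*$ for every packing $P$. For $\alpha,\beta\ge 1$ it is $(\alpha,\beta)$-feasible if (1') some packing $P\subseteq Q\cup\mathcal I_T$ has $p(P)\ge\frac1\alpha p^*$ and (2') $U_P(Q)\le\beta p^*$ for every packing $P$. Let $|Q^*|$ be the minimum cardinality of a feasible query set. **Theorem.** Fix $0<\varepsilon<1$. There is a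 pseudopolynomial algorithm that, given an instance (with all of its data, including the profits), computes a $\left(\frac1{1-\varepsilon},\,2(1+\varepsilon)\right)$-feasible query set $Q$ with $|Q|\le 2|Q^*|$. Here pseudopolynomial means that one program and one polynomial $q$, both depending only on $\varepsilon$, serve all instances, and that the running time is at most $q(\ell+B)$, where $\ell$ is the input length. This holds for arbitrary real profits and interval limits on a real RAM (the arithmetic operations $+,-,\cdot$ and comparisons of reals have unit cost, a real number has length $1$, and integers are charged by their binary length), and the same program satisfies the same bound in the bit (logarithmic-cost) model on all instances with rational profits and interval limits, given in binary. -/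

import Mathlib

/-! ## Knapsack under explorable uncertainty (offline) -/

namespace KnapExp

/-- An instance `(I, B, w, p, A)` of the offline problem, with items `Fin n`. Every uncertainty
interval is either the open interval `(lower i, upper i)`, which contains the profit, or it is
trivial, equal to `{profit i}`, and then `lower i = upper i = profit i`. -/
structure Instance where
  n : ℕ
  capacity : ℕ
  weight : Fin n → ℕ
  profit : Fin n → ℝ
  lower : Fin n → ℝ
  upper : Fin n → ℝ
  weight_le : ∀ i, weight i ≤ capacity
  profit_nonneg : ∀ i, 0 ≤ profit i
  profit_mem : ∀ i, profit i ∈ Set.Ioo (lower i) (upper i) ∨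
    (lower i = profit i ∧ upper i = profit i)

namespace Instance

noncomputable section

variable (K : Instance)

/-- The set of trivial items. -/
def trivialItems : Finset (Fin K.n) :=
  Finset.univ.filter fun i => K.lower i = K.upper i

/-- Packings: sets of items that fit into the knapsack. -/
def IsPacking (P : Finset (Fin K.n)) : Prop :=
  ∑ i ∈ P, K.weight i ≤ K.capacity

/-- The profit `p(P)`. -/
def totalProfit (P : Finset (Fin K.n)) : ℝ :=
  ∑ i ∈ P, K.profit i

/-- The finite set of all packings. -/
def packings : Finset (Finset (Fin K.n)) :=
  Finset.univ.filter fun P => ∑ i ∈ P, K.weight i ≤ K.capacity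

theorem packings_nonempty : K.packings.Nonempty :=
  ⟨∅, by simp [packings]⟩

/-- The optimal profit `p*`, the maximum of `p(P)` over all packings `P`. -/
def optProfit : ℝ :=
  K.packings.sup' K.packings_nonempty K.totalProfit

/-- The upper limit `U_i(Q)` of item `i` after querying `Q`. -/
def upperAfter (Q : Finset (Fin K.n)) (i : Fin K.n) : ℝ :=
  if i ∈ Q then K.profit i else K.upper i

/-- The upper limit `U_P(Q)` of the set `P` after querying `Q`. -/
def totalUpper (Q P : Finset (Fin K.n)) : ℝ :=
  ∑ i ∈ P, K.upperAfter Q i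

/-- Feasible query sets. -/
def IsFeasible (Q : Finset (Fin K.n)) : Prop :=
  (∃ P, K.IsPacking P ∧ P ⊆ Q ∪ K.trivialItems ∧ K.totalProfit P = K.optProfit) ∧
  ∀ P, K.IsPacking P → K.totalUpper Q P ≤ K.optProfit

/-- `(α, β)`-feasible query sets (used for `α, β ≥ 1`). -/
def IsApproxFeasible (α β : ℝ) (Q : Finset (Fin K.n)) : Prop :=
  (∃ P, K.IsPacking P ∧ P ⊆ Q ∪ K.trivialItems ∧ 1 / α * K.optProfit ≤ K.totalProfit P) ∧
  ∀ P, K.IsPacking P → K.totalUpper Q P ≤ β * K.optProfit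

/-- `|Q*|`, the minimum cardinality of a feasible query set. -/
def minQueries : ℕ :=
  sInf {k | ∃ Q : Finset (Fin K.n), K.IsFeasible Q ∧ Q.card = k}

/-- All profits and interval limits are rational numbers. -/
def IsRational : Prop :=
  ∀ i, (∃ q : ℚ, (q : ℝ) = K.lower i) ∧ (∃ q : ℚ, (q : ℝ) = K.upper i) ∧
    (∃ q : ℚ, (q : ℝ) = K.profit i)

/-- The length of the instance when an integer is written in binary and a real number `x` has
length `sz x`. -/
def inputLength (sz : ℝ → ℕ) : ℕ :=
  K.n.size + K.capacity.size +
    ∑ i, (1 + (K.weight i).size + sz (K.lower i) + sz (K.upper i) + sz (K.profit i))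

end

end Instance

/-! ## Random access machine programs and their running time

A machine has a memory of integer arrays and of real arrays. A program is one finite text,
independent of the instance, with structured control flow, integer arithmetic, indirect addressing,
and addition, subtraction, multiplication and comparison of reals. There are no real constants
other than casts of integers, and there is no rounding. -/

/-- Memory: `nat a i` and `real a i` are the entries with index `i` of the `a`-th integer array and
of the `a`-th real array. -/
structure Memory where
  nat : ℕ → ℕ → ℕ
  real : ℕ → ℕ → ℝ

/-- Integer expressions (`sub` is truncated subtraction). -/
inductive NExpr where
  | lit (k : ℕ)
  | get (a : ℕ) (i : NExpr)
  | add (e f : NExpr)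
  | sub (e f : NExpr)
  | mul (e f : NExpr)

/-- Real expressions. -/
inductive RExpr where
  | ofNat (e : NExpr)
  | get (a : ℕ) (i : NExpr)
  | add (e f : RExpr)
  | sub (e f : RExpr)
  | mul (e f : RExpr)

/-- Tests. -/
inductive BExpr where
  | natLe (e f : NExpr)
  | realLe (e f : RExpr)
  | neg (b : BExpr)
  | conj (b c : BExpr)

/-- Programs. -/
inductive Program where
  | skip
  | setNat (a : ℕ) (i v : NExpr)
  | setReal (a : ℕ) (i : NExpr) (v : RExpr)
  | seq (c d : Program)
  | ite (b : BExpr) (c d : Program)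
  | loop (b : BExpr) (c : Program)

noncomputable section

/-- Value of an integer expression. -/
def NExpr.eval (m : Memory) : NExpr → ℕ
  | .lit k => k
  | .get a i => m.nat a (i.eval m)
  | .add e f => e.eval m + f.eval m
  | .sub e f => e.eval m - f.eval m
  | .mul e f => e.eval m * f.eval m

/-- Value of a real expression. -/
def RExpr.eval (m : Memory) : RExpr → ℝ
  | .ofNat e => (e.eval m : ℝ)
  | .get a i => m.real a (i.eval m)
  | .add e f => e.eval m + f.eval m
  | .sub e f => e.eval m - f.eval m
  | .mul e f => e.eval m * f.eval m

/-- Truth of a test. -/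
def BExpr.Holds (m : Memory) : BExpr → Prop
  | .natLe e f => e.eval m ≤ f.eval m
  | .realLe e f => e.eval m ≤ f.eval m
  | .neg b => ¬ b.Holds m
  | .conj b c => b.Holds m ∧ c.Holds m

/-- Cost of evaluating an integer expression: each operation costs one plus the number of binary
digits of its result (so its operands, and all addresses, are charged as well). -/
def NExpr.cost (m : Memory) : NExpr → ℕ
  | .lit k => 1 + k.size
  | .get a i => i.cost m + (1 + (m.nat a (i.eval m)).size)
  | .add e f => e.cost m + f.cost m + (1 + (e.eval m + f.eval m).size)
  | .sub e f => e.cost m + f.cost m + (1 + (e.eval m - f.eval m).size)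
  | .mul e f => e.cost m + f.cost m + (1 + (e.eval m * f.eval m).size)

/-- Cost of evaluating a real expression, where a real number `x` has length `sz x`. -/
def RExpr.cost (sz : ℝ → ℕ) (m : Memory) : RExpr → ℕ
  | .ofNat e => e.cost m + (1 + sz (e.eval m : ℝ))
  | .get a i => i.cost m + (1 + sz (m.real a (i.eval m)))
  | .add e f => e.cost sz m + f.cost sz m + (1 + sz (e.eval m + f.eval m))
  | .sub e f => e.cost sz m + f.cost sz m + (1 + sz (e.eval m - f.eval m))
  | .mul e f => e.cost sz m + f.cost sz m + (1 + sz (e.eval m * f.eval m))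

/-- Cost of evaluating a test. -/
def BExpr.cost (sz : ℝ → ℕ) (m : Memory) : BExpr → ℕ
  | .natLe e f => 1 + e.cost m + f.cost m
  | .realLe e f => 1 + e.cost sz m + f.cost sz m
  | .neg b => 1 + b.cost sz m
  | .conj b c => 1 + b.cost sz m + c.cost sz m

/-- Overwrite the entry with index `i` of integer array `a`. -/
def Memory.writeNat (m : Memory) (a i v : ℕ) : Memory :=
  { m with nat := Function.update m.nat a (Function.update (m.nat a) i v) }

/-- Overwrite the entry with index `i` of real array `a`. -/
def Memory.writeReal (m : Memory) (a i : ℕ) (v : ℝ) : Memory :=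
  { m with real := Function.update m.real a (Function.update (m.real a) i v) }

/-- `Runs sz c m m' t`: started on memory `m`, the program `c` halts with memory `m'` after time
`t`, where a real number `x` has length `sz x`. -/
inductive Runs (sz : ℝ → ℕ) : Program → Memory → Memory → ℕ → Prop where
  | skip (m : Memory) : Runs sz .skip m m 1
  | setNat (m : Memory) (a : ℕ) (i v : NExpr) :
      Runs sz (.setNat a i v) m (m.writeNat a (i.eval m) (v.eval m)) (1 + i.cost m + v.cost m)
  | setReal (m : Memory) (a : ℕ) (i : NExpr) (v : RExpr) :
      Runs sz (.setReal a i v) m (m.writeReal a (i.eval m) (v.eval m))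
        (1 + i.cost m + v.cost sz m)
  | seq {c d : Program} {m m' m'' : Memory} {t t' : ℕ} :
      Runs sz c m m' t → Runs sz d m' m'' t' → Runs sz (.seq c d) m m'' (t + t')
  | iteTrue {b : BExpr} {c d : Program} {m m' : Memory} {t : ℕ} :
      b.Holds m → Runs sz c m m' t → Runs sz (.ite b c d) m m' (1 + b.cost sz m + t)
  | iteFalse {b : BExpr} {c d : Program} {m m' : Memory} {t : ℕ} :
      ¬ b.Holds m → Runs sz d m m' t → Runs sz (.ite b c d) m m' (1 + b.cost sz m + t)
  | loopTrue {b : BExpr} {c : Program} {m m' m'' : Memory} {t t' : ℕ} :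
      b.Holds m → Runs sz c m m' t → Runs sz (.loop b c) m' m'' t' →
      Runs sz (.loop b c) m m'' (1 + b.cost sz m + t + t')
  | loopFalse {b : BExpr} {c : Program} {m : Memory} :
      ¬ b.Holds m → Runs sz (.loop b c) m m (1 + b.cost sz m)

/-- Unit cost of real numbers: every operation on reals takes constant time (the real RAM).
Integers are always charged by their binary length. -/
def unitSize : ℝ → ℕ := fun _ => 1

open Classical in
/-- Binary length of a rational number, numerator and denominator in lowest terms. (Irrational
numbers never occur in a run on rational data; they get the dummy value `0`.) -/
def bitSize (x : ℝ) : ℕ :=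
  if h : ∃ q : ℚ, (q : ℝ) = x then h.choose.num.natAbs.size + h.choose.den.size else 0

/-- The memory at the start: integer array `0` holds the number of items and the capacity, integer
array `1` the weights, real arrays `0`, `1`, `2` the lower limits, upper limits and profits. All
other entries are zero. -/
def Instance.input (K : Instance) : Memory where
  nat a j :=
    if a = 0 then (if j = 0 then K.n else if j = 1 then K.capacity else 0)
    else if a = 1 then (if h : j < K.n then K.weight ⟨j, h⟩ else 0)
    else 0
  real a j :=
    if h : j < K.n then
      (if a = 0 then K.lower ⟨j, h⟩
       else if a = 1 then K.upper ⟨j, h⟩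
       else if a = 2 then K.profit ⟨j, h⟩
       else 0)
    else 0

/-- The query set that is read off the memory at the end: item `i` belongs to it if and only if the
entry with index `i` of integer array `2` is not zero. -/
def Instance.output (K : Instance) (m : Memory) : Finset (Fin K.n) :=
  Finset.univ.filter fun i => m.nat 2 i ≠ 0

/-- The program `c` computes, in pseudopolynomial time, a query set with the property `Good` for
every instance. The time is at most `q (length + B)` for a fixed polynomial `q`, where the
capacity `B` is the largest of the numbers `w_i` and `B`. This is required in the real RAM for all
instances, and for the bit complexity (logarithmic cost, profits and interval limits in binary) for
all rational instances. -/
def ComputesInPseudoPolyTime (c : Program)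
    (Good : (K : Instance) → Finset (Fin K.n) → Prop) : Prop :=
  ∃ q : Polynomial ℕ, ∀ K : Instance, ∃ m : Memory,
    Good K (K.output m) ∧
    (∃ t, Runs unitSize c K.input m t ∧
      t ≤ q.eval (K.inputLength unitSize + K.capacity)) ∧
    (K.IsRational → ∃ t, Runs bitSize c K.input m t ∧
      t ≤ q.eval (K.inputLength bitSize + K.capacity))

end

end KnapExp

namespace KnapExp

/-! ### Static step counts, range conditions and write sets -/

/-! The output is the union of two sets, each of cardinality at most `|Q*|`; the first secures
condition (1'), the second condition (2').

The first set consists of the nontrivial items of an optimal packing having as few of them as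
possible. A feasible set contains all nontrivial items of some optimal packing, so this minimum is
at most `|Q*|` (`sum_queryCost_optPacking_le`). A knapsack recursion over items and capacities finds
the packing if pairs (profit, number of nontrivial items) are compared lexicographically
(`not_better_best`).

The second set comes from the fractional knapsack problem. If `Q` is feasible, the integral optimum
for the values `U_i(Q)` is at most `p*`. The greedy fractional solution is a packing plus part of
one break item, hence has value at most `2 p*`; by linear programming duality a price `a / b` per
unit of weight certifies this bound. The price can be taken to be zero or the density of a single
item, so only `2n + 1` prices have to be tried: zero, and for every item its upper limit or its
profit over its weight (`exists_price`, `exists_dual_le`). For a fixed price the dual bound is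
additive over items, so among all query sets of a given cardinality it is least for the items with
the largest gains (`dual_eq`, `sum_le_sum_front`). Trying every price with every prefix of the gain
order therefore produces a certified set no larger than `Q*` (`Selected.card_le`), and weak duality
bounds every packing by `2 p*` (`sum_le_dual`, `Selected.sum_le`). The union even achieves factors
`1` and `2`, so the program does not depend on `ε`.

For the running time, `Achieves` combines total correctness with an operation count and with range
conditions on all intermediate values. Prices are kept as fractions and inequalities are multiplied
out, so there is no division and every real in a run is an integer combination of input numbers with
polynomially bounded coefficients (`Combo`). On rational data all these combinations share one
denominator, which keeps their binary length polynomial (`fits_bitSize`). -/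

/-- Number of operations of an integer expression. -/
def NExpr.nodes : NExpr → ℕ
  | .lit _ => 1
  | .get _ i => i.nodes + 1
  | .add e f => e.nodes + f.nodes + 1
  | .sub e f => e.nodes + f.nodes + 1
  | .mul e f => e.nodes + f.nodes + 1

/-- Number of operations of a real expression. -/
def RExpr.nodes : RExpr → ℕ
  | .ofNat e => e.nodes + 1
  | .get _ i => i.nodes + 1
  | .add e f => e.nodes + f.nodes + 1
  | .sub e f => e.nodes + f.nodes + 1
  | .mul e f => e.nodes + f.nodes + 1

/-- Number of operations of a test. -/
def BExpr.nodes : BExpr → ℕ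
  | .natLe e f => e.nodes + f.nodes + 1
  | .realLe e f => e.nodes + f.nodes + 1
  | .neg b => b.nodes + 1
  | .conj b c => b.nodes + c.nodes + 1

/-- All intermediate values of the expression are at most `N`. -/
def NExpr.Within (N : ℕ) (m : Memory) : NExpr → Prop
  | .lit k => k ≤ N
  | .get a i => i.Within N m ∧ m.nat a (i.eval m) ≤ N
  | .add e f => e.Within N m ∧ f.Within N m ∧ e.eval m + f.eval m ≤ N
  | .sub e f => e.Within N m ∧ f.Within N m
  | .mul e f => e.Within N m ∧ f.Within N m ∧ e.eval m * f.eval m ≤ N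

/-- All intermediate integers are at most `N`, all intermediate reals satisfy `R`. -/
def RExpr.Within (N : ℕ) (R : ℝ → Prop) (m : Memory) : RExpr → Prop
  | .ofNat e => e.Within N m ∧ R (e.eval m)
  | .get a i => i.Within N m ∧ R (m.real a (i.eval m))
  | .add e f => e.Within N R m ∧ f.Within N R m ∧ R (e.eval m + f.eval m)
  | .sub e f => e.Within N R m ∧ f.Within N R m ∧ R (e.eval m - f.eval m)
  | .mul e f => e.Within N R m ∧ f.Within N R m ∧ R (e.eval m * f.eval m)

/-- All intermediate integers are at most `N`, all intermediate reals satisfy `R`. -/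
def BExpr.Within (N : ℕ) (R : ℝ → Prop) (m : Memory) : BExpr → Prop
  | .natLe e f => e.Within N m ∧ f.Within N m
  | .realLe e f => e.Within N R m ∧ f.Within N R m
  | .neg b => b.Within N R m
  | .conj b c => b.Within N R m ∧ c.Within N R m

open Polynomial in
/-- A polynomial bounding the number of operations of a program each of whose loops makes at
most `X` iterations. -/
noncomputable def Program.stepPoly : Program → Polynomial ℕ
  | .skip => 1
  | .setNat _ i v => C (1 + i.nodes + v.nodes)
  | .setReal _ i v => C (1 + i.nodes + v.nodes)
  | .seq c d => c.stepPoly + d.stepPoly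
  | .ite b c d => C (1 + b.nodes) + c.stepPoly + d.stepPoly
  | .loop b c => (X + 1) * (C (1 + b.nodes) + c.stepPoly)

/-- The integer arrays a program may write. -/
def Program.natTargets : Program → List ℕ
  | .skip => []
  | .setNat a _ _ => [a]
  | .setReal _ _ _ => []
  | .seq c d => c.natTargets ++ d.natTargets
  | .ite _ c d => c.natTargets ++ d.natTargets
  | .loop _ c => c.natTargets

/-- The real arrays a program may write. -/
def Program.realTargets : Program → List ℕ
  | .skip => []
  | .setNat _ _ _ => []
  | .setReal a _ _ => [a]
  | .seq c d => c.realTargets ++ d.realTargets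
  | .ite _ c d => c.realTargets ++ d.realTargets
  | .loop _ c => c.realTargets

/-- `m` and `m'` differ only in arrays that `c` may write. -/
def SameOutside (c : Program) (m m' : Memory) : Prop :=
  (∀ a, a ∉ c.natTargets → m'.nat a = m.nat a) ∧
    ∀ a, a ∉ c.realTargets → m'.real a = m.real a

theorem SameOutside.refl (c : Program) (m : Memory) : SameOutside c m m :=
  ⟨fun _ _ => rfl, fun _ _ => rfl⟩

theorem SameOutside.trans {c : Program} {m m' m'' : Memory} (h : SameOutside c m m')
    (h' : SameOutside c m' m'') : SameOutside c m m'' :=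
  ⟨fun a ha => (h'.1 a ha).trans (h.1 a ha), fun a ha => (h'.2 a ha).trans (h.2 a ha)⟩

theorem SameOutside.mono {c d : Program} {m m' : Memory} (h : SameOutside c m m')
    (hn : c.natTargets ⊆ d.natTargets) (hr : c.realTargets ⊆ d.realTargets) :
    SameOutside d m m' :=
  ⟨fun a ha => h.1 a fun h' => ha (hn h'), fun a ha => h.2 a fun h' => ha (hr h')⟩

@[simp] theorem Memory.nat_writeNat (m : Memory) (a i v a' i' : ℕ) :
    (m.writeNat a i v).nat a' i' = if a' = a ∧ i' = i then v else m.nat a' i' := by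
  by_cases h : a' = a
  · subst h; simp [Memory.writeNat, Function.update_apply]
  · simp [Memory.writeNat, h]

theorem Memory.nat_writeNat_ne (m : Memory) (a i v : ℕ) {a' : ℕ} (h : a' ≠ a) :
    (m.writeNat a i v).nat a' = m.nat a' := by
  simp [Memory.writeNat, h]

@[simp] theorem Memory.real_writeNat (m : Memory) (a i v : ℕ) :
    (m.writeNat a i v).real = m.real := rfl

@[simp] theorem Memory.real_writeReal (m : Memory) (a i : ℕ) (v : ℝ) (a' i' : ℕ) :
    (m.writeReal a i v).real a' i' = if a' = a ∧ i' = i then v else m.real a' i' := by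
  by_cases h : a' = a
  · subst h; simp [Memory.writeReal, Function.update_apply]
  · simp [Memory.writeReal, h]

theorem Memory.real_writeReal_ne (m : Memory) (a i : ℕ) (v : ℝ) {a' : ℕ} (h : a' ≠ a) :
    (m.writeReal a i v).real a' = m.real a' := by
  simp [Memory.writeReal, h]

@[simp] theorem Memory.nat_writeReal (m : Memory) (a i : ℕ) (v : ℝ) :
    (m.writeReal a i v).nat = m.nat := rfl

/-- Frame property: facts about arrays that a block does not mention as targets survive it, and the
absence of a target is checked by `decide`. -/
theorem Runs.sameOutside {sz : ℝ → ℕ} {c : Program} {m m' : Memory} {t : ℕ}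
    (h : Runs sz c m m' t) : SameOutside c m m' := by
  induction h with
  | skip m => exact .refl _ _
  | setNat m a i v =>
    refine ⟨fun a' h => m.nat_writeNat_ne _ _ _ ?_, fun _ _ => rfl⟩
    simpa [Program.natTargets] using h
  | setReal m a i v =>
    refine ⟨fun _ _ => rfl, fun a' h => m.real_writeReal_ne _ _ _ ?_⟩
    simpa [Program.realTargets] using h
  | seq _ _ h1 h2 =>
    exact (h1.mono (by simp [Program.natTargets]) (by simp [Program.realTargets])).trans
      (h2.mono (by simp [Program.natTargets]) (by simp [Program.realTargets]))
  | iteTrue _ _ h => exact h.mono (by simp [Program.natTargets]) (by simp [Program.realTargets])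
  | iteFalse _ _ h => exact h.mono (by simp [Program.natTargets]) (by simp [Program.realTargets])
  | loopTrue _ _ _ h1 h2 =>
    exact (h1.mono (by simp [Program.natTargets]) (by simp [Program.realTargets])).trans h2
  | loopFalse _ => exact .refl _ _

/-- Integers up to `N` and reals satisfying `R` have length at most `s`. -/
def Fits (N : ℕ) (R : ℝ → Prop) (sz : ℝ → ℕ) (s : ℕ) : Prop :=
  (∀ v ≤ N, v.size ≤ s) ∧ ∀ x, R x → sz x ≤ s

theorem NExpr.Within.eval_le {N : ℕ} {m : Memory} {e : NExpr} (h : e.Within N m) :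
    e.eval m ≤ N := by
  induction e with
  | lit k => exact h
  | get a i _ => exact h.2
  | add e f _ _ => exact h.2.2
  | sub e f he _ => exact (Nat.sub_le _ _).trans (he h.1)
  | mul e f _ _ => exact h.2.2

section Cost

variable {N : ℕ} {R : ℝ → Prop} {sz : ℝ → ℕ} {s : ℕ} {m : Memory}

/-- Every node costs one plus the length of its value. Truncated subtraction needs no range
condition of its own, since its value is at most the left operand. -/
theorem NExpr.Within.cost_le (hs : ∀ v ≤ N, v.size ≤ s) {e : NExpr} (h : e.Within N m) :
    e.cost m ≤ e.nodes * (s + 1) := by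
  induction e with
  | lit k => have := hs k h; simp only [NExpr.cost, NExpr.nodes]; omega
  | get a i hi =>
    have := hs _ h.2; have := hi h.1
    simp only [NExpr.cost, NExpr.nodes, add_mul, one_mul]; omega
  | add e f he hf =>
    have := hs _ h.2.2; have := he h.1; have := hf h.2.1
    simp only [NExpr.cost, NExpr.nodes, add_mul, one_mul]; omega
  | sub e f he hf =>
    have := hs _ ((Nat.sub_le (e.eval m) (f.eval m)).trans h.1.eval_le)
    have := he h.1; have := hf h.2
    simp only [NExpr.cost, NExpr.nodes, add_mul, one_mul]; omega
  | mul e f he hf =>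
    have := hs _ h.2.2; have := he h.1; have := hf h.2.1
    simp only [NExpr.cost, NExpr.nodes, add_mul, one_mul]; omega

theorem RExpr.Within.cost_le (hs : Fits N R sz s) {e : RExpr} (h : e.Within N R m) :
    e.cost sz m ≤ e.nodes * (s + 1) := by
  induction e with
  | ofNat e =>
    have := hs.2 _ h.2; have := h.1.cost_le hs.1
    simp only [RExpr.cost, RExpr.nodes, add_mul, one_mul]; omega
  | get a i =>
    have := hs.2 _ h.2; have := h.1.cost_le hs.1
    simp only [RExpr.cost, RExpr.nodes, add_mul, one_mul]; omega
  | add e f he hf =>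
    have := hs.2 _ h.2.2; have := he h.1; have := hf h.2.1
    simp only [RExpr.cost, RExpr.nodes, add_mul, one_mul]; omega
  | sub e f he hf =>
    have := hs.2 _ h.2.2; have := he h.1; have := hf h.2.1
    simp only [RExpr.cost, RExpr.nodes, add_mul, one_mul]; omega
  | mul e f he hf =>
    have := hs.2 _ h.2.2; have := he h.1; have := hf h.2.1
    simp only [RExpr.cost, RExpr.nodes, add_mul, one_mul]; omega

theorem BExpr.Within.cost_le (hs : Fits N R sz s) {b : BExpr} (h : b.Within N R m) :
    b.cost sz m ≤ b.nodes * (s + 1) := by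
  induction b with
  | natLe e f =>
    have := h.1.cost_le hs.1; have := h.2.cost_le hs.1
    simp only [BExpr.cost, BExpr.nodes, add_mul, one_mul]; omega
  | realLe e f =>
    have := h.1.cost_le hs; have := h.2.cost_le hs
    simp only [BExpr.cost, BExpr.nodes, add_mul, one_mul]; omega
  | neg b hb =>
    have := hb h
    simp only [BExpr.cost, BExpr.nodes, add_mul, one_mul]; omega
  | conj b c hb hc =>
    have := hb h.1; have := hc h.2
    simp only [BExpr.cost, BExpr.nodes, add_mul, one_mul]; omega

end Cost

theorem Program.stepPoly_mono (c : Program) {N N' : ℕ} (h : N ≤ N') :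
    c.stepPoly.eval N ≤ c.stepPoly.eval N' := by
  induction c with
  | skip => simp [stepPoly]
  | setNat a i v => simp [stepPoly]
  | setReal a i v => simp [stepPoly]
  | seq c d hc hd => simp only [stepPoly, Polynomial.eval_add]; omega
  | ite b c d hc hd => simp only [stepPoly, Polynomial.eval_add, Polynomial.eval_C]; omega
  | loop b c hc =>
    simp only [stepPoly, Polynomial.eval_add, Polynomial.eval_C, Polynomial.eval_mul,
      Polynomial.eval_X, Polynomial.eval_one]
    gcongr

/-! ### Total correctness with running time -/

/-- Started on `m`, the program `c` halts in a memory satisfying `Q`; if integers up to `N` and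
reals in `R` have length at most `s`, the running time is at most `c.stepPoly.eval N * (s + 1)`. -/
def Achieves (N : ℕ) (R : ℝ → Prop) (c : Program) (m : Memory) (Q : Memory → Prop) : Prop :=
  ∃ m', (∀ sz s, Fits N R sz s →
    ∃ t, Runs sz c m m' t ∧ t ≤ c.stepPoly.eval N * (s + 1)) ∧ Q m'

namespace Achieves

variable {N : ℕ} {R : ℝ → Prop} {m : Memory} {Q : Memory → Prop}

theorem mono {c : Program} {Q' : Memory → Prop} (h : Achieves N R c m Q)
    (hQ : ∀ m', SameOutside c m m' → Q m' → Q' m') : Achieves N R c m Q' := by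
  obtain ⟨m', h, hq⟩ := h
  refine ⟨m', h, hQ _ ?_ hq⟩
  -- Any admissible length function produces a run from which the frame property can be read; here
  -- reals have length zero and integers satisfy `v.size ≤ v ≤ N`.
  obtain ⟨t, ht, -⟩ := h (fun _ => 0) N ⟨fun v hv => (Nat.size_le.2 Nat.lt_two_pow_self).trans hv,
    fun _ _ => Nat.zero_le _⟩
  exact ht.sameOutside

theorem skip (h : Q m) : Achieves N R .skip m Q :=
  ⟨m, fun sz s _ => ⟨1, .skip m, by simp [Program.stepPoly]⟩, h⟩

theorem setNat {a : ℕ} {i v : NExpr} (hi : i.Within N m) (hv : v.Within N m)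
    (h : Q (m.writeNat a (i.eval m) (v.eval m))) : Achieves N R (.setNat a i v) m Q := by
  refine ⟨_, fun sz s hs => ⟨_, .setNat m a i v, ?_⟩, h⟩
  have := hi.cost_le hs.1; have := hv.cost_le hs.1
  simp only [Program.stepPoly, Polynomial.eval_C, add_mul, one_mul]; omega

theorem setReal {a : ℕ} {i : NExpr} {v : RExpr} (hi : i.Within N m) (hv : v.Within N R m)
    (h : Q (m.writeReal a (i.eval m) (v.eval m))) : Achieves N R (.setReal a i v) m Q := by
  refine ⟨_, fun sz s hs => ⟨_, .setReal m a i v, ?_⟩, h⟩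
  have := hi.cost_le hs.1; have := hv.cost_le hs
  simp only [Program.stepPoly, Polynomial.eval_C, add_mul, one_mul]; omega

theorem seq {c d : Program} (h : Achieves N R c m fun m' => Achieves N R d m' Q) :
    Achieves N R (.seq c d) m Q := by
  obtain ⟨m', hc, m'', hd, hq⟩ := h
  refine ⟨m'', fun sz s hs => ?_, hq⟩
  obtain ⟨t, ht, hle⟩ := hc sz s hs
  obtain ⟨t', ht', hle'⟩ := hd sz s hs
  refine ⟨_, .seq ht ht', ?_⟩
  simp only [Program.stepPoly, Polynomial.eval_add, add_mul]; omega

theorem ite {b : BExpr} {c d : Program} (hb : b.Within N R m)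
    (hc : b.Holds m → Achieves N R c m Q) (hd : ¬ b.Holds m → Achieves N R d m Q) :
    Achieves N R (.ite b c d) m Q := by
  by_cases h : b.Holds m
  · obtain ⟨m', hc, hq⟩ := hc h
    refine ⟨m', fun sz s hs => ?_, hq⟩
    obtain ⟨t, ht, hle⟩ := hc sz s hs
    refine ⟨_, .iteTrue h ht, ?_⟩
    have := hb.cost_le hs
    simp only [Program.stepPoly, Polynomial.eval_add, Polynomial.eval_C, add_mul, one_mul]
    omega
  · obtain ⟨m', hd, hq⟩ := hd h
    refine ⟨m', fun sz s hs => ?_, hq⟩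
    obtain ⟨t, ht, hle⟩ := hd sz s hs
    refine ⟨_, .iteFalse h ht, ?_⟩
    have := hb.cost_le hs
    simp only [Program.stepPoly, Polynomial.eval_add, Polynomial.eval_C, add_mul, one_mul]
    omega

/-- The index of the invariant counts completed iterations. As the test must hold before step `n`
and fail at `n`, termination and the iteration count come together. -/
theorem loop {b : BExpr} {c : Program} {n : ℕ} (Inv : ℕ → Memory → Prop) (hn : n ≤ N)
    (h0 : Inv 0 m)
    (hstep : ∀ i < n, ∀ m', Inv i m' →
      b.Within N R m' ∧ b.Holds m' ∧ Achieves N R c m' (Inv (i + 1)))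
    (hend : ∀ m', Inv n m' → b.Within N R m' ∧ ¬ b.Holds m' ∧ Q m') :
    Achieves N R (.loop b c) m Q := by
  have key : ∀ r i m, i + r = n → Inv i m → ∃ m', (∀ sz s, Fits N R sz s →
      ∃ t, Runs sz (.loop b c) m m' t ∧
        t ≤ (r + 1) * ((1 + b.nodes) * (s + 1)) + r * (c.stepPoly.eval N * (s + 1))) ∧ Q m' := by
    intro r
    induction r with
    | zero =>
      intro i m hi hI
      obtain rfl : i = n := by omega
      obtain ⟨hw, hb, hq⟩ := hend m hI
      refine ⟨m, fun sz s hs => ⟨_, .loopFalse hb, ?_⟩, hq⟩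
      have := hw.cost_le hs
      simp only [zero_add, one_mul, zero_mul, add_zero, add_mul]
      omega
    | succ r ih =>
      intro i m hi hI
      obtain ⟨hw, hb, m', hc, hI'⟩ := hstep i (by omega) m hI
      obtain ⟨m'', hl, hq⟩ := ih (i + 1) m' (by omega) hI'
      refine ⟨m'', fun sz s hs => ?_, hq⟩
      obtain ⟨t, ht, hle⟩ := hc sz s hs
      obtain ⟨t', ht', hle'⟩ := hl sz s hs
      refine ⟨_, .loopTrue hb ht ht', ?_⟩
      have h1 := hw.cost_le hs
      have h2 : 1 + b.cost sz m ≤ (1 + b.nodes) * (s + 1) := by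
        rw [add_mul]; omega
      rw [add_mul (r + 1) 1, add_mul r 1 (c.stepPoly.eval N * (s + 1))]
      omega
  obtain ⟨m', h, hq⟩ := key n 0 m (by omega) h0
  refine ⟨m', fun sz s hs => ?_, hq⟩
  obtain ⟨t, ht, hle⟩ := h sz s hs
  refine ⟨t, ht, hle.trans ?_⟩
  simp only [Program.stepPoly, Polynomial.eval_add, Polynomial.eval_C, Polynomial.eval_mul,
    Polynomial.eval_X, Polynomial.eval_one]
  calc _ ≤ (N + 1) * ((1 + b.nodes) * (s + 1)) + (N + 1) * (c.stepPoly.eval N * (s + 1)) := by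
        gcongr; omega
    _ = _ := by ring

end Achieves

/-- The integer variable kept in array `a`. -/
abbrev nvar (a : ℕ) : NExpr := .get a (.lit 0)

/-- `for v < e do c`, where the counter `v` is an integer variable. -/
def forLoop (v : ℕ) (e : NExpr) (c : Program) : Program :=
  .seq (.setNat v (.lit 0) (.lit 0))
    (.loop (.natLe (.add (nvar v) (.lit 1)) e)
      (.seq c (.setNat v (.lit 0) (.add (nvar v) (.lit 1)))))

/-- The limit `e` is evaluated anew at every test, so its value must be stable under everything the
loop can write. The strict bound `n < N` is needed because the last test computes `n + 1`. -/
theorem Achieves.forLoop {N : ℕ} {R : ℝ → Prop} {m : Memory} {Q : Memory → Prop} {v : ℕ}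
    {e : NExpr} {c : Program} {n : ℕ} (Inv : ℕ → Memory → Prop) (hn : n < N)
    (hv : v ∉ c.natTargets)
    (he : ∀ m', SameOutside (forLoop v e c) m m' → e.Within N m' ∧ e.eval m' = n)
    (h0 : Inv 0 (m.writeNat v 0 0))
    (hstep : ∀ i < n, ∀ m', SameOutside (KnapExp.forLoop v e c) m m' → m'.nat v 0 = i → Inv i m' →
      Achieves N R c m' fun m'' => Inv (i + 1) (m''.writeNat v 0 (i + 1)))
    (hend : ∀ m', SameOutside (KnapExp.forLoop v e c) m m' → Inv n m' → Q m') :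
    Achieves N R (KnapExp.forLoop v e c) m Q := by
  have hw : ∀ m' : Memory, ∀ x, SameOutside (KnapExp.forLoop v e c) m m' →
      SameOutside (KnapExp.forLoop v e c) m (m'.writeNat v 0 x) := fun m' x h =>
    ⟨fun a ha => by
      rw [Memory.nat_writeNat_ne, h.1 a ha]
      rintro rfl; exact ha (by simp [KnapExp.forLoop, Program.natTargets]), h.2⟩
  refine .seq (.setNat (Nat.zero_le _) (Nat.zero_le _) ?_)
  refine .loop (fun i m' => SameOutside (KnapExp.forLoop v e c) m m' ∧ m'.nat v 0 = i ∧ Inv i m')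
    hn.le ⟨hw _ _ (.refl _ _), by simp [NExpr.eval], h0⟩ ?_ ?_
  · rintro i hi m' ⟨hs, hvi, hI⟩
    obtain ⟨hew, hee⟩ := he m' hs
    refine ⟨⟨⟨⟨Nat.zero_le _, ?_⟩, ?_, ?_⟩, hew⟩, ?_, .seq ?_⟩
    · simp only [NExpr.eval, hvi]; omega
    · simp only [NExpr.Within]; omega
    · simp only [NExpr.eval, hvi]; omega
    · simp only [BExpr.Holds, NExpr.eval, hvi, hee]; omega
    · refine (hstep i hi m' hs hvi hI).mono fun m'' hs' hI' => ?_
      have hvi' : m''.nat v 0 = i := by rw [hs'.1 v hv, hvi]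
      have hs2 : SameOutside (KnapExp.forLoop v e c) m m'' := hs.trans
        (hs'.mono (by simp [KnapExp.forLoop, Program.natTargets])
          (by simp [KnapExp.forLoop, Program.realTargets]))
      refine .setNat (Nat.zero_le _) ⟨⟨Nat.zero_le _, ?_⟩, ?_, ?_⟩ ?_
      · simp only [NExpr.eval, hvi']; omega
      · simp only [NExpr.Within]; omega
      · simp only [NExpr.eval, hvi']; omega
      · simp only [NExpr.eval, hvi']
        exact ⟨hw _ _ hs2, by simp, hI'⟩
  · rintro m' ⟨hs, hvi, hI⟩
    obtain ⟨hew, hee⟩ := he m' hs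
    refine ⟨⟨⟨⟨Nat.zero_le _, ?_⟩, ?_, ?_⟩, hew⟩, ?_, hend m' hs hI⟩
    · simp only [NExpr.eval, hvi]; omega
    · simp only [NExpr.Within]; omega
    · simp only [NExpr.eval, hvi]; omega
    · simp only [BExpr.Holds, NExpr.eval, hvi, hee]; omega

open Finset

/-! ### Lexicographic knapsack recursion -/

/-- `x` has larger first component, or the same first and a smaller second component. -/
def Better (x y : ℝ × ℕ) : Prop :=
  y.1 < x.1 ∨ (y.1 ≤ x.1 ∧ x.2 < y.2)

theorem Better.not_of_not {x y z : ℝ × ℕ} (h : Better y x) (hz : ¬ Better z x) : ¬ Better z y := by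
  unfold Better at *
  push Not at *
  rcases h with h | h
  · exact ⟨by linarith [hz.1], fun h' => by linarith [hz.1]⟩
  · refine ⟨by linarith [hz.1], fun h' => ?_⟩
    have := hz.2 (by linarith)
    omega

theorem not_better_trans {x y z : ℝ × ℕ} (h : ¬ Better x y) (h' : ¬ Better y z) :
    ¬ Better x z := by
  unfold Better at *
  push Not at *
  refine ⟨by linarith [h.1, h'.1], fun hz => ?_⟩
  have := h.2 (by linarith [h'.1])
  have := h'.2 (by linarith [h.1])
  omega

theorem better_add_right {x y z : ℝ × ℕ} : Better (x + z) (y + z) ↔ Better x y := by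
  simp [Better]

section Recursion

variable (w : ℕ → ℕ) (p : ℕ → ℝ) (c : ℕ → ℕ)

open Classical in
/-- The optimal profit with items below `i` and capacity `b`, and the least cost of a set with this
profit. -/
noncomputable def best : ℕ → ℕ → ℝ × ℕ
  | 0, _ => 0
  | i + 1, b =>
    if w i ≤ b ∧ Better (best i (b - w i) + (p i, c i)) (best i b) then
      best i (b - w i) + (p i, c i)
    else best i b

/-- Item `i` improves on the best solution with earlier items. -/
def Takes (i b : ℕ) : Prop :=
  w i ≤ b ∧ Better (best w p c i (b - w i) + (p i, c i)) (best w p c i b)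

open Classical in
/-- The set realizing `best`. -/
noncomputable def chosen : ℕ → ℕ → Finset ℕ
  | 0, _ => ∅
  | i + 1, b => if Takes w p c i b then insert i (chosen i (b - w i)) else chosen i b

variable {w p c}

theorem best_succ_of_takes {i b : ℕ} (h : Takes w p c i b) :
    best w p c (i + 1) b = best w p c i (b - w i) + (p i, c i) := if_pos h

theorem best_succ_of_not_takes {i b : ℕ} (h : ¬ Takes w p c i b) :
    best w p c (i + 1) b = best w p c i b := if_neg h

theorem chosen_succ_of_takes {i b : ℕ} (h : Takes w p c i b) :
    chosen w p c (i + 1) b = insert i (chosen w p c i (b - w i)) := if_pos h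

theorem chosen_succ_of_not_takes {i b : ℕ} (h : ¬ Takes w p c i b) :
    chosen w p c (i + 1) b = chosen w p c i b := if_neg h

variable (w p c)

theorem chosen_subset (i b : ℕ) : chosen w p c i b ⊆ range i := by
  induction i generalizing b with
  | zero => simp [chosen]
  | succ i ih =>
    by_cases h : Takes w p c i b
    · rw [chosen_succ_of_takes h]
      exact insert_subset (by simp) ((ih _).trans (range_subset_range.2 (Nat.le_succ _)))
    · rw [chosen_succ_of_not_takes h]
      exact (ih _).trans (range_subset_range.2 (Nat.le_succ _))

theorem notMem_chosen (i b : ℕ) : i ∉ chosen w p c i b := fun h => by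
  simpa using chosen_subset w p c i b h

theorem sum_weight_chosen (i b : ℕ) : ∑ x ∈ chosen w p c i b, w x ≤ b := by
  induction i generalizing b with
  | zero => simp [chosen]
  | succ i ih =>
    by_cases h : Takes w p c i b
    · rw [chosen_succ_of_takes h, sum_insert (notMem_chosen w p c _ _)]
      have := ih (b - w i); have := h.1; omega
    · rw [chosen_succ_of_not_takes h]; exact ih b

theorem best_eq_sum_chosen (i b : ℕ) :
    best w p c i b = (∑ x ∈ chosen w p c i b, p x, ∑ x ∈ chosen w p c i b, c x) := by
  induction i generalizing b with
  | zero => simp [chosen, best, Prod.ext_iff]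
  | succ i ih =>
    by_cases h : Takes w p c i b
    · rw [chosen_succ_of_takes h, sum_insert (notMem_chosen w p c _ _), sum_insert (notMem_chosen w p c _ _),
        best_succ_of_takes h, ih, Prod.mk_add_mk, add_comm, add_comm (c i)]
    · rw [chosen_succ_of_not_takes h, best_succ_of_not_takes h, ih]

/-- The lexicographic order is invariant under translation. If the last item is in `S`, erasing it
gives a competitor for the reduced capacity, and adding the item back to both sides preserves the
comparison. -/
theorem not_better_best (i b : ℕ) (S : Finset ℕ) (hS : S ⊆ range i) (hb : ∑ x ∈ S, w x ≤ b) :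
    ¬ Better (∑ x ∈ S, p x, ∑ x ∈ S, c x) (best w p c i b) := by
  induction i generalizing b S with
  | zero =>
    obtain rfl : S = ∅ := by simpa using hS
    simp [Better, best]
  | succ i ih =>
    by_cases hi : i ∈ S
    · have hw := add_sum_erase S w hi
      have hp := sum_erase_add S p hi
      have hc := sum_erase_add S c hi
      have h1 := ih (b - w i) (S.erase i) (fun x hx => by
        have := hS (mem_of_mem_erase hx); have := ne_of_mem_erase hx
        simp only [mem_range] at *; omega) (by omega)
      rw [← better_add_right (z := (p i, c i)), Prod.mk_add_mk, hp, hc] at h1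
      by_cases h : Takes w p c i b
      · rwa [best_succ_of_takes h]
      · rw [best_succ_of_not_takes h]
        exact not_better_trans h1 fun h' => h ⟨by omega, h'⟩
    · have h1 := ih b S (fun x hx => by
        have := hS hx; have : x ≠ i := by rintro rfl; exact hi hx
        simp only [mem_range] at *; omega) hb
      by_cases h : Takes w p c i b
      · rw [best_succ_of_takes h]
        exact h.2.not_of_not h1
      · rwa [best_succ_of_not_takes h]

end Recursion

/-! ### The fractional knapsack bound -/

/-- Take `S` of maximal cardinality among the fitting sets between `T` and `T'`. It is not all of
`T'`, and by maximality any missing item fails to fit. -/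
theorem exists_break_item {T T' : Finset ℕ} {w : ℕ → ℕ} {B : ℕ} (hT : T ⊆ T')
    (h : ∑ i ∈ T, w i ≤ B) (h' : B < ∑ i ∈ T', w i) :
    ∃ S j, T ⊆ S ∧ S ⊆ T' ∧ j ∈ T' ∧ j ∉ S ∧ ∑ i ∈ S, w i ≤ B ∧ B ≤ ∑ i ∈ S, w i + w j := by
  obtain ⟨S, hS, hmax⟩ := exists_max_image
    (T'.powerset.filter fun S => T ⊆ S ∧ ∑ i ∈ S, w i ≤ B) card ⟨T, by simp [hT, h]⟩
  simp only [mem_filter, mem_powerset] at hS hmax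
  obtain ⟨j, hj, hjS⟩ : ∃ j ∈ T', j ∉ S := by
    by_contra! hc
    rw [hS.1.antisymm hc] at hS
    omega
  refine ⟨S, j, hS.2.1, hS.1, hj, hjS, hS.2.2, ?_⟩
  by_contra! hlt
  have := hmax (insert j S) ⟨insert_subset hj hS.1, hS.2.1.trans (subset_insert _ _), by
    rw [sum_insert hjS]; omega⟩
  rw [card_insert_of_notMem hjS] at this
  omega

/-- If every set of items of weight at most `B` has value at most `V`, then some price per unit
of weight shows that the fractional knapsack optimum is at most `2 V`. -/
theorem exists_price {n B : ℕ} {w : ℕ → ℕ} {u : ℕ → ℝ} {V : ℝ} (hu : ∀ i < n, 0 ≤ u i)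
    (hw : ∀ i < n, w i ≤ B) (hV : ∀ S ⊆ range n, ∑ i ∈ S, w i ≤ B → ∑ i ∈ S, u i ≤ V) :
    ∃ (a : ℝ) (b : ℕ), ((a = 0 ∧ b = 1) ∨ ∃ j < n, a = u j ∧ b = w j) ∧ 1 ≤ b ∧
      a * B + ∑ i ∈ range n, max (b * u i - a * w i) 0 ≤ 2 * b * V := by
  have hV0 : 0 ≤ V := by simpa using hV ∅ (by simp) (by simp)
  -- If all items fit together, capacity is worth nothing and price zero suffices.
  by_cases h0 : ∑ i ∈ range n, w i ≤ B
  · refine ⟨0, 1, .inl ⟨rfl, rfl⟩, le_rfl, ?_⟩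
    have h1 : ∑ i ∈ range n, max ((1 : ℕ) * u i - 0 * w i) 0 = ∑ i ∈ range n, u i :=
      sum_congr rfl fun i hi => by
        rw [max_eq_left] <;> simp [hu i (mem_range.1 hi)]
    have := hV (range n) subset_rfl h0
    rw [h1]
    push_cast
    linarith
  push Not at h0
  -- The items strictly denser than `j`, with the comparison multiplied out so that zero weights are
  -- allowed.
  let T := fun j => (range n).filter fun i => u j * w i < w j * u i
  -- A densest item of `A` has no strictly denser item inside `A`.
  have hsub : ∀ A ⊆ range n, A.Nonempty → (∀ i ∈ A, 0 < w i) →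
      ∃ j ∈ A, T j ⊆ range n \ A := by
    intro A hA hne hpos
    obtain ⟨j, hj, hmax⟩ := exists_max_image A (fun i => u i / w i) hne
    refine ⟨j, hj, fun i hi => ?_⟩
    simp only [T, mem_filter] at hi
    refine mem_sdiff.2 ⟨hi.1, fun hiA => ?_⟩
    have h1 : (0 : ℝ) < w i := by exact_mod_cast hpos i hiA
    have h2 : (0 : ℝ) < w j := by exact_mod_cast hpos j hj
    have := hmax i hiA
    rw [div_le_div_iff₀ h1 h2] at this
    linarith [hi.2]
  -- The least dense item whose strictly denser items still fit will supply the break price. The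
  -- candidates are not empty: only items of weight zero are strictly denser than a densest item of
  -- positive weight.
  let C := (range n).filter fun j => 0 < w j ∧ ∑ i ∈ T j, w i ≤ B
  have hC : C.Nonempty := by
    obtain ⟨j, hj, hT⟩ := hsub ((range n).filter fun i => 0 < w i) (filter_subset _ _) (by
      by_contra hne
      rw [not_nonempty_iff_eq_empty, filter_eq_empty_iff] at hne
      rw [sum_eq_zero fun i hi => by have := hne hi; omega] at h0
      omega) (by simp)
    refine ⟨j, mem_filter.2 ⟨(mem_filter.1 hj).1, (mem_filter.1 hj).2, ?_⟩⟩
    rw [sum_eq_zero]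
    · omega
    · intro i hi
      have := hT hi
      simp_all
  obtain ⟨j, hjC, hmin⟩ := exists_min_image C (fun i => u i / w i) hC
  obtain ⟨hjn, hjw, hjT⟩ : j ∈ range n ∧ 0 < w j ∧ ∑ i ∈ T j, w i ≤ B := by simpa [C] using hjC
  have hjw' : (0 : ℝ) < w j := by exact_mod_cast hjw
  let T' := (range n).filter fun i => u j * w i ≤ w j * u i
  have hTT' : T j ⊆ T' := fun i hi => by
    simp only [T, T', mem_filter] at hi ⊢
    exact ⟨hi.1, hi.2.le⟩
  -- If all items at least as dense as `j` did fit, a densest item `k` outside `T'` would be a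
  -- candidate as well, and it would be less dense than `j`, contrary to minimality.
  have hT' : B < ∑ i ∈ T', w i := by
    by_contra! hle
    have hpos : ∀ i ∈ range n \ T', 0 < w i := fun i hi => by
      simp only [T', mem_sdiff, mem_filter, not_and, not_le] at hi
      have h1 := hi.2 hi.1
      by_contra! h2
      obtain h2 : w i = 0 := by omega
      rw [h2] at h1
      have := mul_nonneg hjw'.le (hu i (mem_range.1 hi.1))
      simp only [Nat.cast_zero, mul_zero] at h1
      linarith
    obtain ⟨k, hk, hkT⟩ := hsub (range n \ T') sdiff_subset (by
      rw [sdiff_nonempty]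
      intro hs
      exact absurd (sum_le_sum_of_subset (f := w) hs) (by omega)) hpos
    have hkn := (mem_sdiff.1 hk).1
    rw [Finset.sdiff_sdiff_eq_self (filter_subset _ _)] at hkT
    have hmk := hmin k (mem_filter.2 ⟨hkn, hpos k hk, (sum_le_sum_of_subset hkT).trans hle⟩)
    have hkw : (0 : ℝ) < w k := by exact_mod_cast hpos k hk
    rw [div_le_div_iff₀ hjw' hkw] at hmk
    refine (mem_sdiff.1 hk).2 (mem_filter.2 ⟨hkn, ?_⟩)
    linarith
  obtain ⟨S, l, hTS, hST', hl, hlS, hSB, hBS⟩ := exists_break_item hTT' hjT hT'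
  have hSn : S ⊆ range n := hST'.trans (filter_subset _ _)
  -- Items of `T'` outside `T j` have exactly the break density and hence surplus zero. So the
  -- positive surpluses may be summed over the packing `S`, and the break item `l` can be exchanged
  -- for its weight at the price of `j`.
  have htie : ∀ i ∈ T', i ∉ T j → w j * u i = u j * w i := fun i hi hi' => by
    simp only [T, T', mem_filter] at hi hi'
    exact (le_antisymm hi.2 (not_lt.1 fun h => hi' ⟨hi.1, h⟩)).symm
  refine ⟨u j, w j, .inr ⟨j, mem_range.1 hjn, rfl, rfl⟩, hjw, ?_⟩
  have e1 : ∑ i ∈ range n, max (w j * u i - u j * w i) 0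
      = ∑ i ∈ T j, (w j * u i - u j * w i) := by
    rw [sum_filter]
    refine sum_congr rfl fun i _ => ?_
    split_ifs with h
    · exact max_eq_left (by linarith)
    · exact max_eq_right (by linarith)
  have e2 : ∑ i ∈ T j, (w j * u i - u j * w i) = ∑ i ∈ S, (w j * u i - u j * w i) :=
    sum_subset hTS fun i hi hi' => by rw [htie i (hST' hi) hi', sub_self]
  have e3 : (w j : ℝ) * u l = u j * w l := htie l hl fun h => hlS (hTS h)
  have hln : l ∈ range n := (mem_filter.1 hl).1
  -- The break item alone is a packing; together with `S` it yields the factor two.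
  have hl1 : u l ≤ V := by
    simpa using hV {l} (by simpa using hln) (by simpa using hw l (mem_range.1 hln))
  have hS1 := hV S hSn hSB
  have hB' : (B : ℝ) ≤ ∑ i ∈ S, (w i : ℝ) + w l := by exact_mod_cast hBS
  rw [e1, e2, sum_sub_distrib, ← mul_sum, ← mul_sum]
  have := mul_le_mul_of_nonneg_left hB' (hu j (mem_range.1 hjn))
  have := mul_le_mul_of_nonneg_left (add_le_add hS1 hl1) hjw'.le
  nlinarith

/-! ### Sets of items with the largest gains -/

/-- Item `i` precedes item `j` in the order of decreasing `g`. -/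
def Before (g : ℕ → ℝ) (i j : ℕ) : Prop :=
  g j < g i ∨ (g j ≤ g i ∧ i < j)

open Classical in
/-- The items before `j`. -/
noncomputable def front (g : ℕ → ℝ) (n j : ℕ) : Finset ℕ :=
  (range n).filter fun i => Before g i j

theorem front_subset (g : ℕ → ℝ) (n j : ℕ) : front g n j ⊆ range n := by
  classical exact filter_subset _ _

theorem mem_front {g : ℕ → ℝ} {n i j : ℕ} : i ∈ front g n j ↔ i < n ∧ Before g i j := by
  classical simp [front]

theorem Before.card_lt {g : ℕ → ℝ} {n i j : ℕ} (hi : i < n) (h : Before g i j) :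
    (front g n i).card < (front g n j).card := by
  refine card_lt_card ((ssubset_iff_of_subset fun k hk => ?_).2
    ⟨i, mem_front.2 ⟨hi, h⟩, fun h' => ?_⟩)
  · rw [mem_front] at hk ⊢
    refine ⟨hk.1, ?_⟩
    rcases hk.2 with h1 | h1 <;> rcases h with h2 | h2
    · exact .inl (by linarith)
    · exact .inl (by linarith)
    · exact .inl (by linarith)
    · exact .inr ⟨by linarith, by omega⟩
  · have := (mem_front.1 h').2
    simp [Before] at this

theorem card_front_lt {g : ℕ → ℝ} {n j : ℕ} (hj : j < n) : (front g n j).card < n := by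
  have : front g n j ⊂ range n := (ssubset_iff_of_subset (front_subset _ _ _)).2
    ⟨j, mem_range.2 hj, fun h => by simpa [Before] using (mem_front.1 h).2⟩
  simpa using card_lt_card this

/-- Ties are broken by index, so distinct items have distinct ranks; an injection of `range n` into
itself is onto. Thus every cardinality below `n` occurs as a prefix. -/
theorem exists_card_front {n k : ℕ} (g : ℕ → ℝ) (hk : k < n) :
    ∃ j < n, (front g n j).card = k := by
  have := surj_on_of_inj_on_of_card_le (s := range n) (t := range n)
    (fun j _ => (front g n j).card) (fun j hj => mem_range.2 (card_front_lt (mem_range.1 hj)))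
    (fun i j hi hj h => by
      by_contra hne
      have : Before g i j ∨ Before g j i := by
        unfold Before
        rcases lt_trichotomy (g i) (g j) with h | h | h
        · exact .inr (.inl h)
        · rcases Nat.lt_or_gt_of_ne hne with h' | h'
          · exact .inl (.inr ⟨h.ge, h'⟩)
          · exact .inr (.inr ⟨h.le, h'⟩)
        · exact .inl (.inl h)
      rcases this with h' | h'
      · exact absurd (h'.card_lt (mem_range.1 hi)) (by omega)
      · exact absurd (h'.card_lt (mem_range.1 hj)) (by omega)) le_rfl k (mem_range.2 hk)
  obtain ⟨j, hj, h⟩ := this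
  exact ⟨j, mem_range.1 hj, h.symm⟩

/-- Exchange argument: after removing common items both sides have equally many, and `g j` separates
their gains. -/
theorem sum_le_sum_front {g : ℕ → ℝ} {n j : ℕ} {S : Finset ℕ} (hS : S ⊆ range n)
    (hc : S.card = (front g n j).card) : ∑ i ∈ S, g i ≤ ∑ i ∈ front g n j, g i := by
  rw [← sum_sdiff_le_sum_sdiff]
  have hcard : (S \ front g n j).card = (front g n j \ S).card := by
    have := card_sdiff_add_card_inter S (front g n j)
    have := card_sdiff_add_card_inter (front g n j) S
    rw [inter_comm] at this
    omega
  calc _ ≤ (S \ front g n j).card • g j := sum_le_card_nsmul _ _ _ fun i hi => by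
        rw [mem_sdiff, mem_front] at hi
        by_contra! h
        exact hi.2 ⟨mem_range.1 (hS hi.1), .inl h⟩
    _ = (front g n j \ S).card • g j := by rw [hcard]
    _ ≤ _ := card_nsmul_le_sum _ _ _ fun i hi => by
        rcases (mem_front.1 (mem_sdiff.1 hi).1).2 with h | h
        · exact h.le
        · exact h.1

/-! ### Integer combinations of the input numbers -/

/-- `x` is a combination of input numbers and `1` with integer coefficients whose absolute values
sum up to at most `k`. -/
inductive Combo (K : Instance) : ℕ → ℝ → Prop where
  | input (a i : ℕ) : Combo K 1 (K.input.real a i)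
  | one : Combo K 1 1
  | zero : Combo K 0 0
  | add {k l : ℕ} {x y : ℝ} : Combo K k x → Combo K l y → Combo K (k + l) (x + y)
  | neg {k : ℕ} {x : ℝ} : Combo K k x → Combo K k (-x)
  | mono {k l : ℕ} {x : ℝ} : Combo K k x → k ≤ l → Combo K l x

namespace Combo

variable {K : Instance} {k l : ℕ} {x y : ℝ}

theorem sub (hx : Combo K k x) (hy : Combo K l y) : Combo K (k + l) (x - y) := by
  rw [sub_eq_add_neg]; exact hx.add hy.neg

/-- Integer factors are the only factors needed: the program never multiplies two input reals, so a
pseudopolynomial bound on coefficients can be maintained. -/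
theorem natMul (a : ℕ) (hx : Combo K k x) : Combo K (a * k) (a * x) := by
  induction a with
  | zero => simpa using zero
  | succ a ih => rw [add_mul, Nat.cast_add, add_mul]; simpa using ih.add hx

theorem natCast (a : ℕ) : Combo K a a := by simpa using natMul a one

theorem max_zero (hx : Combo K k x) : Combo K k (max x 0) := by
  rcases max_choice x 0 with h | h <;> rw [h]
  · exact hx
  · exact zero.mono (Nat.zero_le _)

theorem sum {s : Finset ℕ} {f : ℕ → ℝ} (h : ∀ i ∈ s, Combo K k (f i)) :
    Combo K (s.card * k) (∑ i ∈ s, f i) := by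
  classical
  induction s using Finset.induction_on with
  | empty => simpa using zero
  | insert i s hi ih =>
    rw [sum_insert hi, card_insert_of_notMem hi, add_mul, one_mul, add_comm (s.card * k)]
    exact (h i (mem_insert_self _ _)).add (ih fun j hj => h j (mem_insert_of_mem hj))

/-- A common denominator of the inputs remains one for all integer combinations; only the absolute
value grows, at most linearly in the coefficient sum. -/
theorem bounded {D : ℕ} {M : ℝ} (hM : 1 ≤ M)
    (hD : ∀ a i, (∃ z : ℤ, K.input.real a i * D = z) ∧ |K.input.real a i| ≤ M)
    (hx : Combo K k x) : (∃ z : ℤ, x * D = z) ∧ |x| ≤ k * M := by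
  induction hx with
  | input a i => simpa using hD a i
  | one => exact ⟨⟨D, by simp⟩, by simpa using hM⟩
  | zero => exact ⟨⟨0, by simp⟩, by simp⟩
  | add _ _ hx hy =>
    obtain ⟨⟨z, hz⟩, hx⟩ := hx
    obtain ⟨⟨z', hz'⟩, hy⟩ := hy
    refine ⟨⟨z + z', by push_cast; rw [add_mul, hz, hz']⟩, (abs_add_le _ _).trans ?_⟩
    push_cast; linarith
  | neg _ hx =>
    obtain ⟨⟨z, hz⟩, hx⟩ := hx
    exact ⟨⟨-z, by push_cast; rw [neg_mul, hz]⟩, by rwa [abs_neg]⟩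
  | mono _ hkl hx =>
    exact ⟨hx.1, hx.2.trans (by gcongr)⟩

end Combo

/-! ### Lengths of rational numbers -/

theorem bitSize_ratCast (q : ℚ) : bitSize (q : ℝ) = q.num.natAbs.size + q.den.size := by
  have h : ∃ r : ℚ, (r : ℝ) = q := ⟨q, rfl⟩
  have h' : h.choose = q := by exact_mod_cast h.choose_spec
  rw [bitSize, dif_pos h, h']

/-- The reduced denominator divides `D`, and the numerator is `|x|` times the denominator, at most
`k * 2 ^ l * 2 ^ l`. The crude estimate `k < 2 ^ k` accounts for the summand `k`. -/
theorem bitSize_le {x : ℝ} {D k l : ℕ} (hD0 : 0 < D) (hD : D ≤ 2 ^ l) (hz : ∃ z : ℤ, x * D = z)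
    (hx : |x| ≤ k * 2 ^ l) : bitSize x ≤ k + 3 * l + 2 := by
  obtain ⟨z, hz⟩ := hz
  have hD' : (D : ℝ) ≠ 0 := by positivity
  obtain ⟨q, hq⟩ : ∃ q : ℚ, (q : ℝ) = x :=
    ⟨z / D, by push_cast; rw [← hz]; field_simp⟩
  subst hq
  have hqz : q * D = z := by exact_mod_cast hz
  have hden : q.den ≤ D := by
    have hD0' : (D : ℤ) ≠ 0 := by exact_mod_cast hD0.ne'
    have h : q = Rat.divInt z D := by
      rw [Rat.divInt_eq_div, eq_div_iff (by exact_mod_cast hD0.ne')]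
      exact_mod_cast hqz
    have := Rat.den_dvd z D
    rw [← h] at this
    exact Nat.le_of_dvd hD0 (by exact_mod_cast this)
  have hnum : (q.num.natAbs : ℝ) = |(q : ℝ)| * q.den := by
    have h1 : (q : ℝ) * q.den = q.num := by exact_mod_cast Rat.mul_den_eq_num q
    have h2 : (q.num.natAbs : ℝ) = |(q.num : ℝ)| := by
      rw [Nat.cast_natAbs]; push_cast; rfl
    rw [h2, ← h1, abs_mul, Nat.abs_cast]
  have hk : k < 2 ^ k := Nat.lt_two_pow_self
  have hl : 0 < 2 ^ l := by positivity
  have hnum' : q.num.natAbs ≤ k * 2 ^ l * 2 ^ l := by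
    have : (q.num.natAbs : ℝ) ≤ (k * 2 ^ l * 2 ^ l : ℕ) := by
      rw [hnum]; push_cast
      have h3 : (q.den : ℝ) ≤ 2 ^ l := by exact_mod_cast hden.trans hD
      gcongr
    exact_mod_cast this
  have h1 : q.num.natAbs.size ≤ k + l + l := by
    rw [Nat.size_le, pow_add, pow_add]
    exact lt_of_le_of_lt hnum' (by gcongr)
  have h2 : q.den.size ≤ l + 1 := by
    rw [Nat.size_le, pow_succ]
    have := hden.trans hD
    omega
  rw [bitSize_ratCast]
  omega

theorem bitSize_den_le (q : ℚ) : q.den ≤ 2 ^ bitSize (q : ℝ) := by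
  rw [bitSize_ratCast]
  exact ((Nat.lt_size_self _).le).trans (Nat.pow_le_pow_right (by norm_num) (by omega))

theorem abs_le_bitSize (q : ℚ) : |(q : ℝ)| ≤ 2 ^ bitSize (q : ℝ) := by
  rw [bitSize_ratCast]
  have h1 : (q : ℝ) * q.den = q.num := by exact_mod_cast Rat.mul_den_eq_num q
  have h2 : (1 : ℝ) ≤ q.den := by exact_mod_cast q.pos
  have h3 : |(q : ℝ)| ≤ q.num.natAbs := by
    have h4 : (q.num.natAbs : ℝ) = |(q.num : ℝ)| := by
      rw [Nat.cast_natAbs]; push_cast; rfl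
    rw [h4, ← h1, abs_mul, Nat.abs_cast]
    nlinarith [abs_nonneg (q : ℝ)]
  refine h3.trans ?_
  have : q.num.natAbs ≤ 2 ^ (q.num.natAbs.size + q.den.size) :=
    ((Nat.lt_size_self _).le).trans (Nat.pow_le_pow_right (by norm_num) (by omega))
  exact_mod_cast this

theorem fits_unitSize (N : ℕ) (R : ℝ → Prop) : Fits N R unitSize (N + 1) :=
  ⟨fun v hv => (Nat.size_le.2 Nat.lt_two_pow_self).trans (by omega),
    fun x _ => by simp [unitSize]⟩

/-! ### Input data indexed by natural numbers, and their lengths. -/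

namespace Instance

variable (K : Instance)

/-- The weights, extended by zero. -/
noncomputable def wt : ℕ → ℕ := K.input.nat 1

/-- The lower limits, extended by zero. -/
noncomputable def lo : ℕ → ℝ := K.input.real 0

/-- The upper limits, extended by zero. -/
noncomputable def up : ℕ → ℝ := K.input.real 1

/-- The profits, extended by zero. -/
noncomputable def pr : ℕ → ℝ := K.input.real 2

open Classical in
/-- The cost of packing an item: `0` if it is trivial and `1` otherwise. -/
noncomputable def queryCost (i : ℕ) : ℕ := if K.up i ≤ K.lo i then 0 else 1

theorem wt_val (i : Fin K.n) : K.wt i = K.weight i := by simp [wt, input]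
theorem lo_val (i : Fin K.n) : K.lo i = K.lower i := by simp [lo, input]
theorem up_val (i : Fin K.n) : K.up i = K.upper i := by simp [up, input]
theorem pr_val (i : Fin K.n) : K.pr i = K.profit i := by simp [pr, input]

theorem wt_le (i : ℕ) : K.wt i ≤ K.capacity := by
  by_cases h : i < K.n
  · simpa [wt, input, h] using K.weight_le ⟨i, h⟩
  · simp [wt, input, h]

theorem pr_nonneg (i : ℕ) : 0 ≤ K.pr i := by
  by_cases h : i < K.n
  · simpa [pr, input, h] using K.profit_nonneg ⟨i, h⟩
  · simp [pr, input, h]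

theorem profit_le_upper (i : Fin K.n) : K.profit i ≤ K.upper i := by
  rcases K.profit_mem i with h | h
  · exact h.2.le
  · exact h.2.ge

theorem up_nonneg (i : ℕ) : 0 ≤ K.up i := by
  by_cases h : i < K.n
  · simpa [up, input, h] using (K.profit_nonneg ⟨i, h⟩).trans (K.profit_le_upper ⟨i, h⟩)
  · simp [up, input, h]

/-- An open interval containing the profit has its lower limit strictly below its upper one, so the
one-sided test made by the program detects exactly the trivial items. -/
theorem queryCost_val (i : Fin K.n) :
    K.queryCost i = if i ∈ K.trivialItems then 0 else 1 := by
  have : K.up i ≤ K.lo i ↔ K.lower i = K.upper i := by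
    rw [up_val, lo_val]
    rcases K.profit_mem i with h | h
    · have := h.1.trans h.2
      constructor <;> intro <;> linarith
    · rw [h.1, h.2]; simp
  simp [queryCost, trivialItems, this]

theorem n_le_inputLength (sz : ℝ → ℕ) : K.n ≤ K.inputLength sz := by
  have : ∑ _i : Fin K.n, 1 ≤ ∑ i, (1 + (K.weight i).size + sz (K.lower i) + sz (K.upper i) +
      sz (K.profit i)) := sum_le_sum fun i _ => by omega
  simp only [sum_const, card_univ, Fintype.card_fin, smul_eq_mul, mul_one] at this
  unfold inputLength
  omega

/-- The product of all input denominators works: each is at most two to the power of its binary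
length, and these lengths add up to no more than the input length. -/
theorem exists_common_denominator (hK : K.IsRational) :
    ∃ D : ℕ, 0 < D ∧ D ≤ 2 ^ K.inputLength bitSize ∧
      ∀ a i, (∃ z : ℤ, K.input.real a i * D = z) ∧
        |K.input.real a i| ≤ 2 ^ K.inputLength bitSize := by
  choose ql hl using fun i => (hK i).1
  choose qu hu using fun i => (hK i).2.1
  choose qp hp using fun i => (hK i).2.2
  have hlen : ∑ i, (bitSize (K.lower i) + bitSize (K.upper i) + bitSize (K.profit i)) ≤
      K.inputLength bitSize := by
    unfold inputLength
    refine le_trans (sum_le_sum fun i _ => ?_) (Nat.le_add_left _ _)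
    omega
  have hterm : ∀ i, bitSize (K.lower i) + bitSize (K.upper i) + bitSize (K.profit i) ≤
      K.inputLength bitSize := fun i => (single_le_sum
        (f := fun i => bitSize (K.lower i) + bitSize (K.upper i) + bitSize (K.profit i))
        (fun _ _ => Nat.zero_le _) (mem_univ i)).trans hlen
  have hmul : ∀ (q : ℚ) (D : ℕ), q.den ∣ D → ∃ z : ℤ, (q : ℝ) * D = z := by
    rintro q _ ⟨e, rfl⟩
    have h1 : (q : ℝ) * q.den = q.num := by exact_mod_cast Rat.mul_den_eq_num q
    exact ⟨q.num * e, by push_cast; rw [← mul_assoc, h1]⟩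
  have habs : ∀ (q : ℚ) (l : ℕ), bitSize (q : ℝ) ≤ l → |(q : ℝ)| ≤ 2 ^ l := fun q l h =>
    (abs_le_bitSize q).trans (pow_le_pow_right₀ (by norm_num) h)
  refine ⟨∏ i, (ql i).den * (qu i).den * (qp i).den, ?_, ?_, fun a i => ?_⟩
  · exact prod_pos fun i _ => mul_pos (mul_pos (ql i).pos (qu i).pos) (qp i).pos
  · refine le_trans ?_ (Nat.pow_le_pow_right (by norm_num) hlen)
    rw [← prod_pow_eq_pow_sum]
    refine prod_le_prod' fun i _ => ?_
    rw [pow_add, pow_add, ← hl i, ← hu i, ← hp i]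
    exact Nat.mul_le_mul (Nat.mul_le_mul (bitSize_den_le _) (bitSize_den_le _))
      (bitSize_den_le _)
  · by_cases h : i < K.n
    · have hd : (ql ⟨i, h⟩).den * (qu ⟨i, h⟩).den * (qp ⟨i, h⟩).den ∣
          ∏ i, (ql i).den * (qu i).den * (qp i).den := dvd_prod_of_mem _ (mem_univ _)
      have := hterm ⟨i, h⟩
      simp only [input, h, dite_true]
      split_ifs
      · rw [← hl] at this ⊢
        exact ⟨hmul _ _ (dvd_trans ⟨_, mul_assoc _ _ _⟩ hd), habs _ _ (by omega)⟩
      · rw [← hu] at this ⊢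
        exact ⟨hmul _ _ (dvd_trans ⟨(ql ⟨i, h⟩).den * (qp ⟨i, h⟩).den, by ring⟩ hd),
          habs _ _ (by omega)⟩
      · rw [← hp] at this ⊢
        exact ⟨hmul _ _ (dvd_trans ⟨_, mul_comm _ _⟩ hd), habs _ _ (by omega)⟩
      · exact ⟨⟨0, by simp⟩, by simp⟩
    · simp only [input, h, dite_false]
      exact ⟨⟨0, by simp⟩, by simp⟩

theorem fits_bitSize (hK : K.IsRational) (N : ℕ) :
    Fits N (Combo K N) bitSize (N + 3 * K.inputLength bitSize + 2) := by
  obtain ⟨D, hD0, hD, h⟩ := K.exists_common_denominator hK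
  refine ⟨fun v hv => ?_, fun x hx => ?_⟩
  · have : v.size ≤ v := Nat.size_le.2 Nat.lt_two_pow_self
    omega
  · obtain ⟨h1, h2⟩ := hx.bounded (one_le_pow₀ (by norm_num)) h
    exact bitSize_le hD0 hD h1 h2

/-! ### Correctness of the query set -/

/-- The optimal profit, as computed by the recursion. -/
noncomputable def opt : ℝ := (best K.wt K.pr K.queryCost K.n K.capacity).1

/-- The optimal packing with the fewest nontrivial items. -/
noncomputable def optPacking : Finset ℕ := chosen K.wt K.pr K.queryCost K.n K.capacity

theorem sum_le_opt {S : Finset ℕ} (hS : S ⊆ range K.n) (hw : ∑ i ∈ S, K.wt i ≤ K.capacity) :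
    ∑ i ∈ S, K.pr i ≤ K.opt := by
  have := not_better_best K.wt K.pr K.queryCost K.n K.capacity S hS hw
  unfold Better at this
  push Not at this
  exact this.1

theorem sum_val {α : Type*} [AddCommMonoid α] (S : Finset (Fin K.n)) (f : ℕ → α) :
    ∑ i ∈ S, f i = ∑ i ∈ S.map Fin.valEmbedding, f i := by simp

theorem map_val_subset (S : Finset (Fin K.n)) : S.map Fin.valEmbedding ⊆ range K.n := fun i hi => by
  obtain ⟨j, _, rfl⟩ := mem_map.1 hi
  simp

theorem exists_map_val {S : Finset ℕ} (hS : S ⊆ range K.n) :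
    ∃ P : Finset (Fin K.n), P.map Fin.valEmbedding = S :=
  ⟨S.attachFin fun i hi => mem_range.1 (hS hi), by simp⟩

theorem isPacking_iff (P : Finset (Fin K.n)) :
    K.IsPacking P ↔ ∑ i ∈ P.map Fin.valEmbedding, K.wt i ≤ K.capacity := by
  rw [← sum_val]; simp [IsPacking, wt_val]

theorem totalProfit_eq (P : Finset (Fin K.n)) :
    K.totalProfit P = ∑ i ∈ P.map Fin.valEmbedding, K.pr i := by
  rw [← sum_val]; simp [totalProfit, pr_val]

theorem totalUpper_eq (Q P : Finset (Fin K.n)) :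
    K.totalUpper Q P = ∑ i ∈ P.map Fin.valEmbedding,
      if i ∈ Q.map Fin.valEmbedding then K.pr i else K.up i := by
  rw [← sum_val]
  refine sum_congr rfl fun i _ => ?_
  simp [upperAfter, pr_val, up_val, Fin.val_inj]

theorem exists_optPacking : ∃ P, K.IsPacking P ∧ P.map Fin.valEmbedding = K.optPacking ∧
    K.totalProfit P = K.opt := by
  obtain ⟨P, hP⟩ := K.exists_map_val (chosen_subset K.wt K.pr K.queryCost K.n K.capacity)
  refine ⟨P, ?_, hP, ?_⟩
  · rw [isPacking_iff, hP]; exact sum_weight_chosen ..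
  · rw [totalProfit_eq, hP, opt, best_eq_sum_chosen]

theorem optProfit_eq : K.optProfit = K.opt := by
  refine le_antisymm (sup'_le _ _ fun P hP => ?_) ?_
  · rw [totalProfit_eq]
    exact K.sum_le_opt (K.map_val_subset P)
      ((K.isPacking_iff P).1 (by simpa [packings, IsPacking] using hP))
  · obtain ⟨P, hP, -, h⟩ := K.exists_optPacking
    rw [← h]
    exact le_sup' K.totalProfit (by simpa [packings, IsPacking] using hP)

theorem opt_nonneg : 0 ≤ K.opt := by simpa using K.sum_le_opt (S := ∅) (by simp) (by simp)

/-- Numerators of the prices per unit of weight that have to be tried. -/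
noncomputable def priceNum (c : ℕ) : ℝ :=
  if c = 0 then 0 else if c ≤ K.n then K.up (c - 1) else K.pr (c - 1 - K.n)

/-- Denominators of the prices per unit of weight that have to be tried. -/
noncomputable def priceDen (c : ℕ) : ℕ :=
  if c = 0 then 1 else if c ≤ K.n then K.wt (c - 1) else K.wt (c - 1 - K.n)

/-- Scaled surplus of item `i` over its price if it is not queried. -/
noncomputable def upSurplus (c i : ℕ) : ℝ :=
  max (K.priceDen c * K.up i - K.priceNum c * K.wt i) 0

/-- Scaled surplus of item `i` over its price if it is queried. -/
noncomputable def prSurplus (c i : ℕ) : ℝ :=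
  max (K.priceDen c * K.pr i - K.priceNum c * K.wt i) 0

/-- Decrease of the bound `dual` if item `i` is queried. -/
noncomputable def gain (c i : ℕ) : ℝ := K.upSurplus c i - K.prSurplus c i

open Classical in
/-- Scaled upper bound on the fractional knapsack optimum after querying `S`. -/
noncomputable def dual (c : ℕ) (S : Finset ℕ) : ℝ :=
  K.priceNum c * K.capacity +
    ∑ i ∈ range K.n, if i ∈ S then K.prSurplus c i else K.upSurplus c i

/-- The items preceding item `j` in the order of decreasing gain for price `c`. -/
noncomputable def prefixSet (c j : ℕ) : Finset ℕ := front (K.gain c) K.n j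

/-- The bound certifies that `prefixSet c j` is good enough. -/
def Passes (c j : ℕ) : Prop :=
  1 ≤ K.priceDen c ∧ K.dual c (K.prefixSet c j) ≤ 2 * K.priceDen c * K.opt

/-- `S` is a smallest set found by trying the pairs `(c, j)` for which `T c j` holds. -/
def Selected (T : ℕ → ℕ → Prop) (S : Finset ℕ) : Prop :=
  S ⊆ range K.n ∧ (S = range K.n ∨ ∃ c j, K.Passes c j ∧ S = K.prefixSet c j) ∧
    ∀ c j, T c j → K.Passes c j → S.card ≤ (K.prefixSet c j).card

variable {K}

/-- Weak duality: split each scaled value into the price of its weight and a remainder. The weights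
pay at most the price of the full capacity, and remainders are at most the nonnegative surpluses. -/
theorem sum_le_dual (c : ℕ) {S P : Finset ℕ} (hP : P ⊆ range K.n)
    (ha : 0 ≤ K.priceNum c) (hw : ∑ i ∈ P, K.wt i ≤ K.capacity) :
    K.priceDen c * ∑ i ∈ P, (if i ∈ S then K.pr i else K.up i) ≤ K.dual c S := by
  classical
  have hw' : (∑ i ∈ P, (K.wt i : ℝ)) ≤ K.capacity := by exact_mod_cast hw
  calc _ = ∑ i ∈ P, K.priceNum c * K.wt i + ∑ i ∈ P, (K.priceDen c *
        (if i ∈ S then K.pr i else K.up i) - K.priceNum c * K.wt i) := by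
        rw [← sum_add_distrib, mul_sum]; exact sum_congr rfl fun i _ => by ring
    _ ≤ K.priceNum c * K.capacity +
        ∑ i ∈ P, (if i ∈ S then K.prSurplus c i else K.upSurplus c i) := by
        rw [← mul_sum]
        refine add_le_add (mul_le_mul_of_nonneg_left hw' ha) (sum_le_sum fun i _ => ?_)
        split_ifs <;> exact le_max_left _ _
    _ ≤ _ := by
        unfold dual
        have := sum_le_sum_of_subset_of_nonneg
          (f := fun i => if i ∈ S then K.prSurplus c i else K.upSurplus c i) hP fun i _ _ => by
            split_ifs <;> exact le_max_right _ _
        linarith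

theorem priceNum_nonneg (K : Instance) (c : ℕ) : 0 ≤ K.priceNum c := by
  unfold priceNum
  split_ifs
  · exact le_rfl
  · exact K.up_nonneg _
  · exact K.pr_nonneg _

/-- For a fixed price the bound is a constant minus a sum of gains over `S`, so among sets of a
given size it is least for the largest gains. -/
theorem dual_eq (K : Instance) (c : ℕ) {S : Finset ℕ} (hS : S ⊆ range K.n) :
    K.dual c S = K.priceNum c * K.capacity + ∑ i ∈ range K.n, K.upSurplus c i -
      ∑ i ∈ S, K.gain c i := by
  classical
  have h1 : ∑ i ∈ S, K.gain c i = ∑ i ∈ range K.n, if i ∈ S then K.gain c i else 0 := by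
    rw [← sum_filter, filter_mem_eq_inter, inter_eq_right.2 hS]
  rw [h1, add_sub_assoc, ← sum_sub_distrib, dual]
  congr 1
  refine sum_congr rfl fun i _ => ?_
  split_ifs <;> simp [gain]

/-- Every feasible query set is certified by one of the prices. -/
theorem exists_dual_le {Q : Finset (Fin K.n)} (hQ : K.IsFeasible Q) :
    ∃ c < 2 * K.n + 1, 1 ≤ K.priceDen c ∧
      K.dual c (Q.map Fin.valEmbedding) ≤ 2 * K.priceDen c * K.opt := by
  classical
  set S := Q.map Fin.valEmbedding with hS
  obtain ⟨a, b, hab, hb, h⟩ := exists_price (n := K.n) (B := K.capacity) (w := K.wt)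
    (u := fun i => if i ∈ S then K.pr i else K.up i) (V := K.opt)
    (fun i _ => by split_ifs; exacts [K.pr_nonneg i, K.up_nonneg i])
    (fun i _ => K.wt_le i) (fun T hT hw => by
      obtain ⟨P, rfl⟩ := K.exists_map_val hT
      rw [← K.optProfit_eq, hS, ← totalUpper_eq]
      exact hQ.2 P ((K.isPacking_iff P).2 hw))
  -- Index `0` encodes price zero, `j + 1` the density of an unqueried item `j`, and `n + 1 + j`
  -- that of a queried one.
  obtain ⟨c, hc, rfl, rfl⟩ : ∃ c < 2 * K.n + 1, K.priceNum c = a ∧ K.priceDen c = b := by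
    rcases hab with ⟨rfl, rfl⟩ | ⟨j, hj, rfl, rfl⟩
    · exact ⟨0, by omega, by simp [priceNum], by simp [priceDen]⟩
    · by_cases hjS : j ∈ S
      · refine ⟨K.n + 1 + j, by omega, ?_, ?_⟩
        · rw [priceNum, if_neg (by omega), if_neg (by omega), if_pos hjS]; congr 1; omega
        · rw [priceDen, if_neg (by omega), if_neg (by omega)]; congr 1; omega
      · refine ⟨j + 1, by omega, ?_, ?_⟩
        · rw [priceNum, if_neg (by omega), if_pos (by omega), if_neg hjS]; congr 1
        · rw [priceDen, if_neg (by omega), if_pos (by omega)]; congr 1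
  refine ⟨c, hc, hb, le_trans (le_of_eq ?_) h⟩
  unfold dual
  congr 1
  refine sum_congr rfl fun i _ => ?_
  split_ifs <;> rfl

/-- Some price certifies `Q`; the prefix of the gain order with as many elements as `Q` has a bound
at least as good for the same price, so it passed the test. If `Q` contains all items, the trivial
bound on `S` suffices. -/
theorem Selected.card_le {S : Finset ℕ} (h : K.Selected (fun c j => c < 2 * K.n + 1 ∧ j < K.n) S)
    {Q : Finset (Fin K.n)} (hQ : K.IsFeasible Q) : S.card ≤ Q.card := by
  have hSn : S.card ≤ K.n := by simpa using card_le_card h.1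
  by_cases hQn : Q.card < K.n
  · obtain ⟨c, hc, hb, hle⟩ := exists_dual_le hQ
    obtain ⟨j, hj, hcard⟩ := exists_card_front (K.gain c) hQn
    rw [← hcard]
    refine h.2.2 c j ⟨hc, hj⟩ ⟨hb, le_trans ?_ hle⟩
    rw [dual_eq K c (K.map_val_subset Q), prefixSet, dual_eq K c (front_subset _ _ _)]
    have := sum_le_sum_front (g := K.gain c) (j := j) (K.map_val_subset Q)
      (by rw [card_map, hcard])
    linarith
  · omega

/-- For a passing prefix this is weak duality divided by the positive price denominator; for the
fallback set of all items the values are the profits themselves. -/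
theorem Selected.sum_le {T : ℕ → ℕ → Prop} {S P : Finset ℕ} (h : K.Selected T S)
    (hP : P ⊆ range K.n) (hw : ∑ i ∈ P, K.wt i ≤ K.capacity) :
    ∑ i ∈ P, (if i ∈ S then K.pr i else K.up i) ≤ 2 * K.opt := by
  rcases h.2.1 with rfl | ⟨c, j, ⟨hb, hd⟩, rfl⟩
  · rw [sum_congr rfl fun i hi => if_pos (hP hi)]
    have := K.sum_le_opt hP hw
    have := K.opt_nonneg
    linarith
  · have h1 := (sum_le_dual c (S := K.prefixSet c j) hP (K.priceNum_nonneg c) hw).trans hd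
    have hb' : (0 : ℝ) < K.priceDen c := by exact_mod_cast hb
    have h2 : K.priceDen c * ∑ i ∈ P, (if i ∈ K.prefixSet c j then K.pr i else K.up i) ≤
        K.priceDen c * (2 * K.opt) := by linarith
    exact le_of_mul_le_mul_left h2 hb'

/-- Querying everything is feasible, so the infimum defining `minQueries` is attained instead of
being the default value of an empty infimum. -/
theorem exists_feasible (K : Instance) :
    ∃ Q : Finset (Fin K.n), K.IsFeasible Q ∧ Q.card = K.minQueries := by
  have : {k | ∃ Q : Finset (Fin K.n), K.IsFeasible Q ∧ Q.card = k}.Nonempty := by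
    refine ⟨_, univ, ⟨?_, fun P hP => ?_⟩, rfl⟩
    · obtain ⟨P, hP, -, h⟩ := K.exists_optPacking
      exact ⟨P, hP, fun _ _ => by simp, by rw [h, optProfit_eq]⟩
    · rw [optProfit_eq, totalUpper_eq]
      rw [sum_congr rfl fun i hi => if_pos (map_subset_map.2 (subset_univ P) hi)]
      exact K.sum_le_opt (K.map_val_subset P) ((K.isPacking_iff P).1 hP)
  exact Nat.sInf_mem this

/-- Feasibility provides an optimal packing whose nontrivial items all lie in `Q`. It ties in profit
with `optPacking`, so the second lexicographic component compares the numbers of nontrivial items.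
-/
theorem sum_queryCost_optPacking_le {Q : Finset (Fin K.n)} (hQ : K.IsFeasible Q) :
    ∑ i ∈ K.optPacking, K.queryCost i ≤ Q.card := by
  obtain ⟨⟨P, hP, hPQ, hprofit⟩, -⟩ := hQ
  have h := not_better_best K.wt K.pr K.queryCost K.n K.capacity _ (K.map_val_subset P)
    ((K.isPacking_iff P).1 hP)
  rw [← totalProfit_eq, hprofit, optProfit_eq] at h
  unfold Better at h
  push Not at h
  have h2 := h.2 le_rfl
  rw [best_eq_sum_chosen] at h2
  refine h2.trans ?_
  rw [← sum_val]
  simp only [queryCost_val]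
  calc ∑ i ∈ P, (if i ∈ K.trivialItems then 0 else 1)
      = (P.filter fun i => i ∉ K.trivialItems).card := by
        rw [card_filter]
        exact sum_congr rfl fun i _ => by split_ifs <;> simp_all
    _ ≤ Q.card := card_le_card fun i hi => by
        rw [mem_filter] at hi
        exact (mem_union.1 (hPQ hi.1)).resolve_right hi.2

/-- Both properties survive taking the union: the optimal packing stays covered, and additional
queries can only lower upper limits because profits do not exceed them. -/
theorem good_of_selected {S : Finset ℕ}
    (h : K.Selected (fun c j => c < 2 * K.n + 1 ∧ j < K.n) S) {Q : Finset (Fin K.n)}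
    (hQ : ∀ i : Fin K.n, i ∈ Q ↔ ((i : ℕ) ∈ K.optPacking ∧ K.queryCost i = 1) ∨ (i : ℕ) ∈ S)
    {ε : ℝ} (hε0 : 0 < ε) :
    K.IsApproxFeasible (1 / (1 - ε)) ((1 + ε) * 2) Q ∧ Q.card ≤ 2 * K.minQueries := by
  classical
  have h0 := K.opt_nonneg
  refine ⟨⟨?_, fun P hP => ?_⟩, ?_⟩
  · obtain ⟨P, hP, hPc, hprofit⟩ := K.exists_optPacking
    refine ⟨P, hP, fun i hi => ?_, ?_⟩
    · rw [mem_union, hQ]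
      by_cases ht : i ∈ K.trivialItems
      · exact .inr ht
      · refine .inl (.inl ⟨?_, by rw [queryCost_val, if_neg ht]⟩)
        rw [← hPc]
        exact mem_map_of_mem _ hi
    · rw [hprofit, optProfit_eq, one_div_one_div]
      nlinarith
  · have h1 : K.totalUpper Q P ≤
        ∑ i ∈ P.map Fin.valEmbedding, if i ∈ S then K.pr i else K.up i := by
      rw [← sum_val]
      refine sum_le_sum fun i _ => ?_
      rw [upperAfter, up_val, pr_val]
      have := K.profit_le_upper i
      split_ifs with h1 h2
      · exact le_rfl
      · exact this
      · exact absurd ((hQ i).2 (.inr ‹_›)) h1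
      · exact le_rfl
    have h2 := h.sum_le (K.map_val_subset P) ((K.isPacking_iff P).1 hP)
    rw [optProfit_eq]
    nlinarith
  · obtain ⟨Q', hQ', hmin⟩ := K.exists_feasible
    have h1 := h.card_le hQ'
    have h2 := sum_queryCost_optPacking_le hQ'
    have h3 : Q.map Fin.valEmbedding ⊆ K.optPacking.filter (fun i => K.queryCost i = 1) ∪ S := by
      intro i hi
      obtain ⟨j, hj, rfl⟩ := mem_map.1 hi
      simpa using (hQ j).1 hj
    have h4 : (K.optPacking.filter fun i => K.queryCost i = 1).card ≤
        ∑ i ∈ K.optPacking, K.queryCost i := by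
      rw [card_filter]
      refine sum_le_sum fun i _ => ?_
      split_ifs <;> omega
    have := (card_le_card h3).trans (card_union_le _ _)
    rw [card_map] at this
    omega

end Instance

/-! ### Building blocks of the program -/

/-- Store the query cost of item `j` at index `i` of integer array `a`. -/
def setCost (a : ℕ) (i j : NExpr) : Program :=
  .ite (.realLe (.get 1 j) (.get 0 j)) (.setNat a i (.lit 0)) (.setNat a i (.lit 1))

/-- Store the positive part of `e` at index `i` of real array `a`. -/
def setPosPart (a : ℕ) (i : NExpr) (e : RExpr) : Program :=
  .ite (.realLe e (.ofNat (.lit 0))) (.setReal a i (.ofNat (.lit 0))) (.setReal a i e)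

/-- Disjunction. -/
def BExpr.or (b c : BExpr) : BExpr := .neg (.conj (.neg b) (.neg c))

@[simp] theorem BExpr.or_holds {m : Memory} {b c : BExpr} :
    (b.or c).Holds m ↔ b.Holds m ∨ c.Holds m := by
  simp only [BExpr.or, BExpr.Holds]; tauto

/-- The number of items. -/
abbrev numItems : NExpr := .get 0 (.lit 0)

/-- The capacity. -/
abbrev cap : NExpr := .get 0 (.lit 1)

/-- Linear index of the entry `(i, b)` of a table with `capacity + 1` columns. -/
abbrev cell (i b : NExpr) : NExpr := .add (.mul i (.add cap (.lit 1))) b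

/-- Compute the table entry for the items up to `nvar 5` and capacity `nvar 6`. -/
def fillCell : Program :=
  .seq (setCost 7 (.lit 0) (nvar 5)) <|
  .seq (.setReal 8 (.lit 0) (.add (.get 3 (cell (nvar 5) (.sub (nvar 6) (.get 1 (nvar 5)))))
    (.get 2 (nvar 5)))) <|
  .seq (.setNat 8 (.lit 0) (.add (.get 3 (cell (nvar 5) (.sub (nvar 6) (.get 1 (nvar 5)))))
    (nvar 7))) <|
  .ite (.conj (.natLe (.get 1 (nvar 5)) (nvar 6))
      (.or (.neg (.realLe (.get 8 (.lit 0)) (.get 3 (cell (nvar 5) (nvar 6)))))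
        (.conj (.realLe (.get 3 (cell (nvar 5) (nvar 6))) (.get 8 (.lit 0)))
          (.neg (.natLe (.get 3 (cell (nvar 5) (nvar 6))) (nvar 8))))))
    (.seq (.setReal 3 (cell (.add (nvar 5) (.lit 1)) (nvar 6)) (.get 8 (.lit 0)))
      (.seq (.setNat 3 (cell (.add (nvar 5) (.lit 1)) (nvar 6)) (nvar 8))
        (.setNat 4 (cell (.add (nvar 5) (.lit 1)) (nvar 6)) (.lit 1))))
    (.seq (.setReal 3 (cell (.add (nvar 5) (.lit 1)) (nvar 6))
        (.get 3 (cell (nvar 5) (nvar 6))))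
      (.seq (.setNat 3 (cell (.add (nvar 5) (.lit 1)) (nvar 6))
          (.get 3 (cell (nvar 5) (nvar 6))))
        (.setNat 4 (cell (.add (nvar 5) (.lit 1)) (nvar 6)) (.lit 0))))

/-- Dynamic programming over items and capacities. -/
def fillTable : Program :=
  forLoop 5 numItems (forLoop 6 (.add cap (.lit 1)) fillCell)

/-- Backtracking through the table: write the nontrivial items of an optimal packing to array
`2`. -/
def markPacking : Program :=
  .seq (.setNat 6 (.lit 0) cap) <|
  forLoop 5 numItems <|
    .seq (.setNat 7 (.lit 0) (.sub (.sub numItems (.lit 1)) (nvar 5))) <|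
    .ite (.natLe (.lit 1) (.get 4 (cell (.add (nvar 7) (.lit 1)) (nvar 6))))
      (.seq (setCost 2 (nvar 7) (nvar 7)) (.setNat 6 (.lit 0) (.sub (nvar 6) (.get 1 (nvar 7)))))
      .skip

/-- Set the price with index `nvar 10`. -/
def setPrice : Program :=
  .ite (.natLe (nvar 10) (.lit 0))
    (.seq (.setReal 4 (.lit 0) (.ofNat (.lit 0))) (.setNat 11 (.lit 0) (.lit 1)))
    (.ite (.natLe (nvar 10) numItems)
      (.seq (.setReal 4 (.lit 0) (.get 1 (.sub (nvar 10) (.lit 1))))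
        (.setNat 11 (.lit 0) (.get 1 (.sub (nvar 10) (.lit 1)))))
      (.seq (.setReal 4 (.lit 0) (.get 2 (.sub (.sub (nvar 10) (.lit 1)) numItems)))
        (.setNat 11 (.lit 0) (.get 1 (.sub (.sub (nvar 10) (.lit 1)) numItems)))))

/-- Scaled surplus of an item with value in real array `a`. -/
abbrev surplus (a : ℕ) : RExpr :=
  .sub (.mul (.ofNat (nvar 11)) (.get a (nvar 5)))
    (.mul (.get 4 (.lit 0)) (.ofNat (.get 1 (nvar 5))))

/-- Compute all surpluses for the current price. -/
def setSurpluses : Program :=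
  forLoop 5 numItems (.seq (setPosPart 5 (nvar 5) (surplus 1)) (setPosPart 6 (nvar 5) (surplus 2)))

/-- The gain of an item. -/
abbrev gainOf (i : NExpr) : RExpr := .sub (.get 5 i) (.get 6 i)

/-- Compute the set of items before `nvar 12`, its cardinality and its bound. -/
def scanPrefix : Program :=
  .seq (.setNat 13 (.lit 0) (.lit 0)) <|
  .seq (.setReal 7 (.lit 0) (.mul (.get 4 (.lit 0)) (.ofNat cap))) <|
  forLoop 5 numItems <|
    .ite (.or (.neg (.realLe (gainOf (nvar 5)) (gainOf (nvar 12))))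
        (.conj (.realLe (gainOf (nvar 12)) (gainOf (nvar 5)))
          (.neg (.natLe (nvar 12) (nvar 5)))))
      (.seq (.setNat 15 (nvar 5) (.lit 1))
        (.seq (.setNat 13 (.lit 0) (.add (nvar 13) (.lit 1)))
          (.setReal 7 (.lit 0) (.add (.get 7 (.lit 0)) (.get 6 (nvar 5))))))
      (.seq (.setNat 15 (nvar 5) (.lit 0))
        (.setReal 7 (.lit 0) (.add (.get 7 (.lit 0)) (.get 5 (nvar 5)))))

/-- Keep the scanned set if its bound is small enough and it is smaller than the current one. -/
def keepSmaller : Program :=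
  .ite (.conj (.natLe (.lit 1) (nvar 11))
      (.conj (.realLe (.get 7 (.lit 0)) (.mul (.ofNat (.mul (.lit 2) (nvar 11)))
          (.get 3 (cell numItems cap))))
        (.neg (.natLe (nvar 9) (nvar 13)))))
    (.seq (.setNat 9 (.lit 0) (nvar 13))
      (forLoop 5 numItems (.setNat 14 (nvar 5) (.get 15 (nvar 5)))))
    .skip

/-- Find the smallest set certified by some price. -/
def selectPrefix : Program :=
  .seq (.setNat 9 (.lit 0) numItems) <|
  .seq (forLoop 5 numItems (.setNat 14 (nvar 5) (.lit 1))) <|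
  forLoop 10 (.add (.mul (.lit 2) numItems) (.lit 1)) <|
    .seq setPrice <| .seq setSurpluses <|
    forLoop 12 numItems (.seq scanPrefix keepSmaller)

/-- Add the selected set to the output. -/
def mergeOutput : Program :=
  forLoop 5 numItems
    (.ite (.natLe (.lit 1) (.get 14 (nvar 5))) (.setNat 2 (nvar 5) (.lit 1)) .skip)

/-- The complete program. -/
def knapsackProgram : Program :=
  .seq fillTable (.seq markPacking (.seq selectPrefix mergeOutput))

/-- The memory still holds the input. -/
def Reads (K : Instance) (m : Memory) : Prop :=
  m.nat 0 0 = K.n ∧ m.nat 0 1 = K.capacity ∧ m.nat 1 = K.wt ∧ m.real 0 = K.lo ∧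
    m.real 1 = K.up ∧ m.real 2 = K.pr

theorem Reads.of_sameOutside {K : Instance} {c : Program} {m m' : Memory} (h : Reads K m)
    (hs : SameOutside c m m') (hn : 0 ∉ c.natTargets ∧ 1 ∉ c.natTargets)
    (hr : 0 ∉ c.realTargets ∧ 1 ∉ c.realTargets ∧ 2 ∉ c.realTargets) : Reads K m' := by
  obtain ⟨h1, h2, h3, h4, h5, h6⟩ := h
  refine ⟨?_, ?_, ?_, ?_, ?_, ?_⟩
  · rw [hs.1 0 hn.1, h1]
  · rw [hs.1 0 hn.1, h2]
  · rw [hs.1 1 hn.2, h3]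
  · rw [hs.2 0 hr.1, h4]
  · rw [hs.2 1 hr.2.1, h5]
  · rw [hs.2 2 hr.2.2, h6]

theorem reads_input (K : Instance) : Reads K K.input :=
  ⟨by simp [Instance.input], by simp [Instance.input], rfl, rfl, rfl, rfl⟩

/-- Bound on all integers and on the coefficient sums of all reals in a run. -/
def rangeBound (K : Instance) : ℕ := 8 * ((K.n + 1) * (K.capacity + 1))

/-- Expanded so that `omega` can treat `K.n * (K.capacity + 1)` as an atom in the range checks. -/
theorem rangeBound_eq (K : Instance) :
    rangeBound K = 8 * (K.n * (K.capacity + 1)) + 8 * (K.capacity + 1) := by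
  unfold rangeBound; ring

theorem n_le_mul (K : Instance) : K.n ≤ K.n * (K.capacity + 1) := Nat.le_mul_of_pos_right _ (by omega)

/-! ### Correctness of the basic blocks and of one table entry. -/

section Blocks

variable {K : Instance} {m : Memory} {Q : Memory → Prop}

theorem achieves_setCost {N : ℕ} {R : ℝ → Prop} {a : ℕ} {i j : NExpr} (hN : 1 ≤ N)
    (hi : i.Within N m) (hj : j.Within N m)
    (h0 : R (m.real 0 (j.eval m))) (h1 : R (m.real 1 (j.eval m))) (hm : Reads K m)
    (hQ : Q (m.writeNat a (i.eval m) (K.queryCost (j.eval m)))) :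
    Achieves N R (setCost a i j) m Q := by
  refine .ite ⟨⟨hj, h1⟩, hj, h0⟩ (fun h => ?_) fun h => ?_
  · refine .setNat hi (Nat.zero_le _) ?_
    simp only [BExpr.Holds, RExpr.eval, hm.2.2.2.1, hm.2.2.2.2.1] at h
    rwa [Instance.queryCost, if_pos h] at hQ
  · refine .setNat hi hN ?_
    simp only [BExpr.Holds, RExpr.eval, hm.2.2.2.1, hm.2.2.2.2.1] at h
    rwa [Instance.queryCost, if_neg h] at hQ

theorem achieves_setPosPart {N : ℕ} {R : ℝ → Prop} {a : ℕ} {i : NExpr} {e : RExpr}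
    (hi : i.Within N m) (he : e.Within N R m) (h0 : R 0)
    (hQ : Q (m.writeReal a (i.eval m) (max (e.eval m) 0))) :
    Achieves N R (setPosPart a i e) m Q := by
  have h0' : RExpr.Within N R m (.ofNat (.lit 0)) := ⟨Nat.zero_le _, by simpa [NExpr.eval] using h0⟩
  refine .ite ⟨he, h0'⟩ (fun h => ?_) fun h => ?_
  · refine .setReal hi h0' ?_
    simp only [BExpr.Holds, RExpr.eval, NExpr.eval, Nat.cast_zero] at h ⊢
    rwa [max_eq_right h] at hQ
  · refine .setReal hi he ?_
    simp only [BExpr.Holds, RExpr.eval, NExpr.eval, Nat.cast_zero, not_le] at h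
    rwa [max_eq_left h.le] at hQ

/-- The table entries with linear index below `k` are filled in. -/
def TableTo (K : Instance) (k : ℕ) (m : Memory) : Prop :=
  ∀ i b, b ≤ K.capacity → i * (K.capacity + 1) + b < k →
    m.real 3 (i * (K.capacity + 1) + b) = (best K.wt K.pr K.queryCost i b).1 ∧
    m.nat 3 (i * (K.capacity + 1) + b) = (best K.wt K.pr K.queryCost i b).2 ∧
    ∀ j, i = j + 1 → (1 ≤ m.nat 4 (i * (K.capacity + 1) + b) ↔ Takes K.wt K.pr K.queryCost j b)
      ∧ m.nat 4 (i * (K.capacity + 1) + b) ≤ 1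

/-- Uniqueness of division with remainder; it guarantees that writing one cell leaves the other
cells intact. -/
theorem cell_inj {B i j b b' : ℕ} (hb : b ≤ B) (hb' : b' ≤ B)
    (h : i * (B + 1) + b = j * (B + 1) + b') : i = j ∧ b = b' := by
  have h1 : i = j := by
    rcases lt_trichotomy i j with h' | h' | h'
    · have := Nat.mul_le_mul_right (B + 1) (Nat.succ_le_of_lt h')
      rw [Nat.succ_mul] at this; omega
    · exact h'
    · have := Nat.mul_le_mul_right (B + 1) (Nat.succ_le_of_lt h')
      rw [Nat.succ_mul] at this; omega
  subst h1
  exact ⟨rfl, by omega⟩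

theorem TableTo.succ {k i b : ℕ} {m' : Memory} (h : TableTo K k m) (hb : b ≤ K.capacity)
    (hk : k = (i + 1) * (K.capacity + 1) + b)
    (h1 : ∀ x, x ≠ k → m'.real 3 x = m.real 3 x) (h2 : ∀ x, x ≠ k → m'.nat 3 x = m.nat 3 x)
    (h3 : ∀ x, x ≠ k → m'.nat 4 x = m.nat 4 x)
    (h4 : m'.real 3 k = (best K.wt K.pr K.queryCost (i + 1) b).1)
    (h5 : m'.nat 3 k = (best K.wt K.pr K.queryCost (i + 1) b).2)
    (h6 : 1 ≤ m'.nat 4 k ↔ Takes K.wt K.pr K.queryCost i b) (h7 : m'.nat 4 k ≤ 1) :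
    TableTo K (k + 1) m' := by
  intro i' b' hb' hlt
  by_cases he : i' * (K.capacity + 1) + b' = k
  · obtain ⟨rfl, rfl⟩ := cell_inj hb' hb (he.trans hk)
    rw [he]
    refine ⟨h4, h5, fun j hj => ?_⟩
    obtain rfl : i = j := by omega
    exact ⟨h6, h7⟩
  · rw [h1 _ he, h2 _ he, h3 _ he]
    exact h i' b' hb' (by omega)

theorem combo_best (K : Instance) (i b : ℕ) :
    Combo K i (best K.wt K.pr K.queryCost i b).1 := by
  rw [best_eq_sum_chosen]
  refine (Combo.sum (k := 1) fun j _ => .input 2 j).mono ?_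
  simpa using card_le_card (chosen_subset K.wt K.pr K.queryCost i b)

theorem best_snd_le (K : Instance) (i b : ℕ) : (best K.wt K.pr K.queryCost i b).2 ≤ i := by
  rw [best_eq_sum_chosen]
  refine (sum_le_card_nsmul _ _ 1 fun j _ => ?_).trans ?_
  · unfold Instance.queryCost; split_ifs <;> simp
  · simpa using card_le_card (chosen_subset K.wt K.pr K.queryCost i b)

theorem queryCost_le (K : Instance) (i : ℕ) : K.queryCost i ≤ 1 := by
  unfold Instance.queryCost; split_ifs <;> simp

theorem achieves_fillCell {i b : ℕ} (hm : Reads K m) (hi : m.nat 5 0 = i) (hb : m.nat 6 0 = b)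
    (hin : i < K.n) (hbB : b ≤ K.capacity)
    (hT : TableTo K ((i + 1) * (K.capacity + 1) + b) m) :
    Achieves (rangeBound K) (Combo K (rangeBound K)) fillCell m
      (TableTo K ((i + 1) * (K.capacity + 1) + b + 1)) := by
  set N := rangeBound K with hNdef
  have hN := rangeBound_eq K
  rw [← hNdef] at hN
  obtain ⟨hn, hB, hw, hlo, hup, hpr⟩ := hm
  have hnm := n_le_mul K
  have hwi := K.wt_le i
  have e1 : i * (K.capacity + 1) ≤ K.n * (K.capacity + 1) := Nat.mul_le_mul_right _ hin.le
  have e2 : (i + 1) * (K.capacity + 1) ≤ K.n * (K.capacity + 1) := Nat.mul_le_mul_right _ hin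
  have e3 : (i + 1) * (K.capacity + 1) = i * (K.capacity + 1) + (K.capacity + 1) := by ring
  obtain ⟨v1, v2, -⟩ := hT i b hbB (by omega)
  -- By truncated subtraction this cell exists even if the item does not fit; the candidate is then
  -- computed but rejected by the test.
  obtain ⟨v3, v4, -⟩ := hT i (b - K.wt i) (by omega) (by omega)
  have c1 := combo_best K i b
  have c2 := combo_best K i (b - K.wt i)
  have c3 := best_snd_le K i b
  have c4 := best_snd_le K i (b - K.wt i)
  have c5 := queryCost_le K i
  have c6 : Combo K 1 (K.pr i) := .input 2 i
  have ci : ∀ a j, Combo K N (K.input.real a j) := fun a j => (Combo.input a j).mono (by omega)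
  have d1 := c1.mono (show i ≤ N by omega)
  have d2 := c2.mono (show i ≤ N by omega)
  have d3 := (c2.add c6).mono (show i + 1 ≤ N by omega)
  have d4 : Combo K N (K.pr i) := ci 2 i
  refine .seq (achieves_setCost (K := K) (by omega) (Nat.zero_le _) ⟨Nat.zero_le _, by
    simp only [NExpr.eval, hi]; omega⟩ (by rw [hlo]; exact ci 0 _) (by rw [hup]; exact ci 1 _)
    ⟨hn, hB, hw, hlo, hup, hpr⟩ ?_)
  have hne : (i + 1) * (K.capacity + 1) + b ≠ 0 := by omega
  have hne' : i * (K.capacity + 1) + b ≠ (i + 1) * (K.capacity + 1) + b := by omega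
  refine .seq (.setReal (Nat.zero_le _) ?_ ?_)
  · simp [RExpr.Within, NExpr.Within, NExpr.eval, RExpr.eval, hi, hb, hw, hB, hpr, v3, d2, d3, d4]
    omega
  refine .seq (.setNat (Nat.zero_le _) ?_ ?_)
  · simp [NExpr.Within, NExpr.eval, hi, hb, hw, hB, v4]
    omega
  refine .ite ?_ ?_ ?_
  · simp [BExpr.or, BExpr.Within, RExpr.Within, NExpr.Within, NExpr.eval, RExpr.eval, hi, hb, hw,
      hB, hpr, v1, v2, v3, v4, d1, d3]
    omega
  · intro h
    have ht : Takes K.wt K.pr K.queryCost i b := by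
      simpa [BExpr.Holds, RExpr.eval, NExpr.eval, hi, hb, hw, hB, hpr, v1, v2, v3, v4, Takes,
        Better] using h
    refine .seq (.setReal ?_ ?_ (.seq (.setNat ?_ ?_ (.setNat ?_ ?_ ?_))))
    · simp [NExpr.Within, NExpr.eval, hi, hb, hB]; omega
    · simp [RExpr.Within, NExpr.Within, NExpr.eval, RExpr.eval, hi, hb, hw, hB, hpr, v3, d3]
    · simp [NExpr.Within, NExpr.eval, hi, hb, hB]; omega
    · simp [NExpr.Within, NExpr.eval, hi, hb, hB, hw, v4]; omega
    · simp [NExpr.Within, NExpr.eval, hi, hb, hB]; omega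
    · simp [NExpr.Within]; omega
    · refine hT.succ hbB rfl ?_ ?_ ?_ ?_ ?_ ?_ ?_ <;>
        simp +contextual [NExpr.eval, RExpr.eval, hi, hb, hB, hw, hpr, v3, v4,
          best_succ_of_takes ht, ht]
  · intro h
    have ht : ¬ Takes K.wt K.pr K.queryCost i b := by
      intro ht
      refine h ?_
      simpa [BExpr.Holds, RExpr.eval, NExpr.eval, hi, hb, hw, hB, hpr, v1, v2, v3, v4, Takes,
        Better] using ht
    refine .seq (.setReal ?_ ?_ (.seq (.setNat ?_ ?_ (.setNat ?_ ?_ ?_))))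
    · simp [NExpr.Within, NExpr.eval, hi, hb, hB]; omega
    · simp [RExpr.Within, NExpr.Within, NExpr.eval, hi, hb, hB, v1, d1]; omega
    · simp [NExpr.Within, NExpr.eval, hi, hb, hB]; omega
    · simp [NExpr.Within, NExpr.eval, hi, hb, hB, v2]; omega
    · simp [NExpr.Within, NExpr.eval, hi, hb, hB]; omega
    · simp [NExpr.Within]
    · refine hT.succ hbB rfl ?_ ?_ ?_ ?_ ?_ ?_ ?_ <;>
        simp +contextual [NExpr.eval, RExpr.eval, hi, hb, hB, v1, v2,
          best_succ_of_not_takes ht, ht]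

end Blocks

/-! ### Correctness of the stages: table, backtracking, price search, output. -/

section Stages

variable {K : Instance} {m : Memory} {Q : Memory → Prop}

theorem TableTo.congr {k : ℕ} {m' : Memory} (h : TableTo K k m) (h1 : m'.real 3 = m.real 3)
    (h2 : m'.nat 3 = m.nat 3) (h3 : m'.nat 4 = m.nat 4) : TableTo K k m' := by
  unfold TableTo; rw [h1, h2, h3]; exact h

theorem Reads.numItems (h : Reads K m) :
    numItems.Within (rangeBound K) m ∧ numItems.eval m = K.n := by
  have := rangeBound_eq K
  have := n_le_mul K
  simp [NExpr.Within, NExpr.eval, h.1]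
  omega

theorem Reads.cap_succ (h : Reads K m) :
    (NExpr.add cap (.lit 1)).Within (rangeBound K) m ∧
      (NExpr.add cap (.lit 1)).eval m = K.capacity + 1 := by
  have := rangeBound_eq K
  simp [NExpr.Within, NExpr.eval, h.2.1]
  omega

theorem achieves_fillTable (hm : Reads K m) (h0 : m.nat 3 = fun _ => 0)
    (h0' : ∀ x, m.real 3 x = 0) :
    Achieves (rangeBound K) (Combo K (rangeBound K)) fillTable m
      (TableTo K ((K.n + 1) * (K.capacity + 1))) := by
  have hN := rangeBound_eq K
  have hnm := n_le_mul K
  refine .forLoop (n := K.n) (fun i m' => TableTo K ((i + 1) * (K.capacity + 1)) m') (by omega)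
    (by decide) (fun m' hs => ?_) ?_ (fun i hi m' hs hv hT => ?_) fun m' hs hT => hT
  · exact (hm.of_sameOutside hs (by decide) (by decide)).numItems
  · intro i b hb hlt
    -- The row without items is never written: it is all zeros, as is the initial memory.
    obtain rfl : i = 0 := by
      by_contra hne
      have := Nat.mul_le_mul_right (K.capacity + 1) (Nat.one_le_iff_ne_zero.2 hne)
      omega
    simp [best, h0, h0']
  · have hm' := hm.of_sameOutside hs (by decide) (by decide)
    refine .forLoop (n := K.capacity + 1)
      (fun b m' => TableTo K ((i + 1) * (K.capacity + 1) + b) m') (by omega)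
      (by decide) (fun m'' hs' => ?_) ?_ (fun b hb m'' hs' hv' hT' => ?_) fun m'' hs' hT' => ?_
    · exact (hm'.of_sameOutside hs' (by decide) (by decide)).cap_succ
    · exact hT.congr rfl (Memory.nat_writeNat_ne _ _ _ _ (by decide))
        (Memory.nat_writeNat_ne _ _ _ _ (by decide))
    · have hm'' := hm'.of_sameOutside hs' (by decide) (by decide)
      have h5 : m''.nat 5 0 = i := by rw [hs'.1 5 (by decide), hv]
      refine (achieves_fillCell hm'' h5 hv' hi (by omega) hT').mono fun m₃ _ h => ?_
      exact h.congr rfl (Memory.nat_writeNat_ne _ _ _ _ (by decide))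
        (Memory.nat_writeNat_ne _ _ _ _ (by decide))
    · rw [← Nat.succ_mul] at hT'
      exact hT'.congr rfl (Memory.nat_writeNat_ne _ _ _ _ (by decide))
        (Memory.nat_writeNat_ne _ _ _ _ (by decide))

-- Items are decided from the last to the first. After `i` rounds the undecided part of `optPacking`
-- is the set chosen by the recursion from the first `n - i` items for the remaining capacity, which
-- variable `6` holds.
open Classical in
theorem achieves_markPacking (hm : Reads K m) (hT : TableTo K ((K.n + 1) * (K.capacity + 1)) m)
    (h0 : ∀ x, m.nat 2 x = 0) :
    Achieves (rangeBound K) (Combo K (rangeBound K)) markPacking m fun m' =>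
      ∀ x, m'.nat 2 x = if x ∈ K.optPacking then K.queryCost x else 0 := by
  set N := rangeBound K with hNdef
  have hN := rangeBound_eq K
  rw [← hNdef] at hN
  have hnm := n_le_mul K
  refine .seq (.setNat (Nat.zero_le _) ?_ ?_)
  · simp only [NExpr.Within, NExpr.eval, hm.2.1]; omega
  have hm1 : Reads K (m.writeNat 6 0 K.capacity) := by
    obtain ⟨h1, h2, h3, h4, h5, h6⟩ := hm
    refine ⟨by simp [h1], by simp [h2], ?_, h4, h5, h6⟩
    rw [Memory.nat_writeNat_ne _ _ _ _ (by decide), h3]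
  have hT1 : TableTo K ((K.n + 1) * (K.capacity + 1)) (m.writeNat 6 0 K.capacity) :=
    hT.congr rfl (Memory.nat_writeNat_ne _ _ _ _ (by decide))
      (Memory.nat_writeNat_ne _ _ _ _ (by decide))
  simp only [NExpr.eval, hm.2.1]
  refine .forLoop (n := K.n) (fun i m' => m'.nat 6 0 ≤ K.capacity ∧
    (∀ x < K.n - i, x ∈ K.optPacking ↔
      x ∈ chosen K.wt K.pr K.queryCost (K.n - i) (m'.nat 6 0)) ∧
    ∀ x, m'.nat 2 x = if K.n - i ≤ x ∧ x ∈ K.optPacking then K.queryCost x else 0) (by omega)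
    (by decide) (fun m' hs => ?_) ?_ ?_ ?_
  · exact (hm1.of_sameOutside hs (by decide) (by decide)).numItems
  · refine ⟨by simp, by simp [Instance.optPacking], fun x => ?_⟩
    have : x ∈ K.optPacking → x < K.n := fun h => by
      simpa using chosen_subset _ _ _ _ _ h
    rw [if_neg (by intro h; have := this h.2; omega)]
    simp [h0]
  · rintro i hi m' hs hv ⟨hb, hiff, hout⟩
    obtain ⟨hn, hB, hw, hlo, hup, hpr⟩ := hm1.of_sameOutside hs (by decide) (by decide)
    have hT' : TableTo K ((K.n + 1) * (K.capacity + 1)) m' :=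
      hT1.congr (hs.2 3 (by decide)) (hs.1 3 (by decide)) (hs.1 4 (by decide))
    obtain ⟨j, hj⟩ : ∃ j, K.n - i = j + 1 := ⟨K.n - i - 1, by omega⟩
    have hj1 : K.n - 1 - i = j := by omega
    have hj2 : K.n - (i + 1) = j := by omega
    have hjn : j < K.n := by omega
    obtain ⟨b, hbv⟩ : ∃ b, m'.nat 6 0 = b := ⟨_, rfl⟩
    rw [hbv] at hb hiff
    rw [hj] at hiff hout
    rw [hj2]
    have e1 : (j + 1) * (K.capacity + 1) ≤ K.n * (K.capacity + 1) := Nat.mul_le_mul_right _ hjn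
    have e2 : (K.n + 1) * (K.capacity + 1) = K.n * (K.capacity + 1) + (K.capacity + 1) := by ring
    obtain ⟨-, -, hX⟩ := hT' (j + 1) b hb (by omega)
    obtain ⟨hX, hX1⟩ := hX j rfl
    have ci : ∀ a j, Combo K N (K.input.real a j) := fun a j => (Combo.input a j).mono (by omega)
    have hwj := K.wt_le j
    refine .seq (.setNat (Nat.zero_le _) ?_ (.ite ?_ ?_ ?_))
    · simp [NExpr.Within, NExpr.eval, hn, hv]; omega
    · simp [BExpr.Within, NExpr.Within, NExpr.eval, hn, hv, hB, hj1, hbv]; omega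
    · intro h
      have ht : Takes K.wt K.pr K.queryCost j b := by
        rw [← hX]
        simpa [BExpr.Holds, NExpr.eval, hn, hv, hB, hj1, hbv] using h
      have hjo : j ∈ K.optPacking := by
        rw [hiff j (by omega), chosen_succ_of_takes ht]; simp
      refine .seq (achieves_setCost (K := K) (by omega) ?_ ?_ (by rw [Memory.real_writeNat, hlo]; exact ci 0 _)
        (by rw [Memory.real_writeNat, hup]; exact ci 1 _) ⟨by simp [hn], by simp [hB], ?_, hlo, hup, hpr⟩
        (.setNat (Nat.zero_le _) ?_ ?_))
      · simp [NExpr.Within, NExpr.eval, hn, hv, hj1]; omega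
      · simp [NExpr.Within, NExpr.eval, hn, hv, hj1]; omega
      · rw [Memory.nat_writeNat_ne _ _ _ _ (by decide), hw]
      · simp [NExpr.Within, NExpr.eval, hn, hv, hj1, hw, hbv]; omega
      · refine ⟨?_, fun x hx => ?_, fun x => ?_⟩
        · simp [NExpr.eval, hn, hv, hj1, hw, hbv]; omega
        · rw [hiff x (by omega), chosen_succ_of_takes ht]
          simp [NExpr.eval, hn, hv, hj1, hw, hbv, hx.ne]
        · simp only [NExpr.eval, hn, hv, hj1, Memory.nat_writeNat, hout]
          rcases lt_trichotomy x j with h' | rfl | h'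
          · simp [h'.ne, h'.not_ge, show ¬ j + 1 ≤ x by omega]
          · simp [hjo]
          · simp [h'.ne', h'.le, show j + 1 ≤ x by omega]
    · intro h
      have ht : ¬ Takes K.wt K.pr K.queryCost j b := by
        rw [← hX]
        simpa [BExpr.Holds, NExpr.eval, hn, hv, hB, hj1, hbv] using h
      have hjo : j ∉ K.optPacking := by
        rw [hiff j (by omega), chosen_succ_of_not_takes ht]; exact notMem_chosen _ _ _ _ _
      refine .skip ⟨by simpa [hbv] using hb, fun x hx => ?_, fun x => ?_⟩
      · rw [hiff x (by omega), chosen_succ_of_not_takes ht]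
        simp [hbv]
      · simp only [Memory.nat_writeNat, hout]
        rcases lt_trichotomy x j with h' | rfl | h'
        · simp [h'.not_ge, show ¬ j + 1 ≤ x by omega]
        · simp [hjo]
        · simp [h'.le, show j + 1 ≤ x by omega]
  · rintro m' - ⟨-, -, hout⟩ x
    simpa using hout x

theorem achieves_setPrice {c : ℕ} (hm : Reads K m) (hc : m.nat 10 0 = c)
    (hcn : c < 2 * K.n + 1) :
    Achieves (rangeBound K) (Combo K (rangeBound K)) setPrice m fun m' =>
      m'.real 4 0 = K.priceNum c ∧ m'.nat 11 0 = K.priceDen c := by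
  set N := rangeBound K with hNdef
  have hN := rangeBound_eq K
  rw [← hNdef] at hN
  have hnm := n_le_mul K
  obtain ⟨hn, hB, hw, hlo, hup, hpr⟩ := hm
  have ci : ∀ a j, Combo K N (K.input.real a j) := fun a j => (Combo.input a j).mono (by omega)
  have hu : ∀ j, Combo K N (K.up j) := ci 1
  have hp : ∀ j, Combo K N (K.pr j) := ci 2
  have hz : Combo K N 0 := Combo.zero.mono (Nat.zero_le _)
  have hwi : ∀ i, K.wt i ≤ N := fun i => by have := K.wt_le i; omega
  refine .ite ?_ (fun h => ?_) fun h => .ite ?_ (fun h' => ?_) fun h' => ?_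
  · simp [BExpr.Within, NExpr.Within, NExpr.eval, hc]; omega
  · simp only [BExpr.Holds, NExpr.eval, hc] at h
    refine .seq (.setReal (Nat.zero_le _) ?_ (.setNat (Nat.zero_le _) ?_ ?_))
    · simpa [RExpr.Within, NExpr.Within, NExpr.eval] using hz
    · simp only [NExpr.Within]; omega
    · simp [Instance.priceNum, Instance.priceDen, show c = 0 by omega, RExpr.eval, NExpr.eval]
  · simp [BExpr.Within, NExpr.Within, NExpr.eval, hc, hn]; omega
  · simp only [BExpr.Holds, NExpr.eval, hc, hn] at h h'
    refine .seq (.setReal (Nat.zero_le _) ?_ (.setNat (Nat.zero_le _) ?_ ?_))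
    · simp [RExpr.Within, NExpr.Within, NExpr.eval, hc, hup, hu]; omega
    · simp [NExpr.Within, NExpr.eval, hc, hw, hwi]; omega
    · simp [Instance.priceNum, Instance.priceDen, show c ≠ 0 by omega, h', RExpr.eval, NExpr.eval,
        hc, hup, hw]
  · simp only [BExpr.Holds, NExpr.eval, hc, hn] at h h'
    refine .seq (.setReal (Nat.zero_le _) ?_ (.setNat (Nat.zero_le _) ?_ ?_))
    · simp [RExpr.Within, NExpr.Within, NExpr.eval, hc, hn, hpr, hp]; omega
    · simp [NExpr.Within, NExpr.eval, hc, hn, hw, hwi]; omega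
    · simp [Instance.priceNum, Instance.priceDen, show c ≠ 0 by omega, h', RExpr.eval, NExpr.eval,
        hc, hn, hpr, hw]

theorem combo_up (K : Instance) (i : ℕ) : Combo K 1 (K.up i) := .input 1 i

theorem combo_pr (K : Instance) (i : ℕ) : Combo K 1 (K.pr i) := .input 2 i

theorem priceDen_le (K : Instance) (c : ℕ) : K.priceDen c ≤ K.capacity + 1 := by
  unfold Instance.priceDen
  split_ifs
  · omega
  · exact (K.wt_le _).trans (by omega)
  · exact (K.wt_le _).trans (by omega)

theorem combo_priceNum (K : Instance) (c : ℕ) : Combo K 1 (K.priceNum c) := by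
  unfold Instance.priceNum
  split_ifs
  · exact Combo.zero.mono (by omega)
  · exact combo_up K _
  · exact combo_pr K _

theorem combo_priceNum_mul (K : Instance) (c : ℕ) {a : ℕ} (ha : a ≤ K.capacity) :
    Combo K (K.capacity + 1) (K.priceNum c * a) := by
  rw [mul_comm]; exact ((combo_priceNum K c).natMul a).mono (by omega)

theorem combo_priceDen_mul (K : Instance) (c : ℕ) {x : ℝ} (hx : Combo K 1 x) :
    Combo K (K.capacity + 1) (K.priceDen c * x) :=
  (hx.natMul _).mono (by have := priceDen_le K c; omega)

theorem combo_upSurplus (K : Instance) (c i : ℕ) :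
    Combo K (2 * (K.capacity + 1)) (K.upSurplus c i) :=
  (((combo_priceDen_mul K c (combo_up K i)).sub
    (combo_priceNum_mul K c (K.wt_le i))).max_zero).mono (by omega)

theorem combo_prSurplus (K : Instance) (c i : ℕ) :
    Combo K (2 * (K.capacity + 1)) (K.prSurplus c i) :=
  (((combo_priceDen_mul K c (combo_pr K i)).sub
    (combo_priceNum_mul K c (K.wt_le i))).max_zero).mono (by omega)

theorem achieves_setSurpluses {c : ℕ} (hm : Reads K m) (ha : m.real 4 0 = K.priceNum c)
    (hb : m.nat 11 0 = K.priceDen c) :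
    Achieves (rangeBound K) (Combo K (rangeBound K)) setSurpluses m fun m' =>
      ∀ i < K.n, m'.real 5 i = K.upSurplus c i ∧ m'.real 6 i = K.prSurplus c i := by
  set N := rangeBound K with hNdef
  have hN := rangeBound_eq K
  rw [← hNdef] at hN
  have hnm := n_le_mul K
  have hnat : ∀ a ≤ N, Combo K N a := fun a h => (Combo.natCast a).mono h
  have hz : Combo K N 0 := Combo.zero.mono (Nat.zero_le _)
  have hbN := priceDen_le K c
  refine .forLoop (n := K.n) (fun i m' => ∀ x < i, m'.real 5 x = K.upSurplus c x ∧
    m'.real 6 x = K.prSurplus c x) (by omega) (by decide) (fun m' hs => ?_) (by simp) ?_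
    fun m' _ h => h
  · exact (hm.of_sameOutside hs (by decide) (by decide)).numItems
  · intro i hi m' hs hv hI
    obtain ⟨hn, hB, hw, hlo, hup, hpr⟩ := hm.of_sameOutside hs (by decide) (by decide)
    have ha' : m'.real 4 0 = K.priceNum c := by rw [hs.2 4 (by decide), ha]
    have hb' : m'.nat 11 0 = K.priceDen c := by rw [hs.1 11 (by decide), hb]
    have hwi := K.wt_le i
    have d1 := (combo_up K i).mono (show 1 ≤ N by omega)
    have d2 := (combo_pr K i).mono (show 1 ≤ N by omega)
    have d3 := combo_priceDen_mul K c (combo_up K i)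
    have d4 := combo_priceDen_mul K c (combo_pr K i)
    have d5 := combo_priceNum_mul K c hwi
    have d6 := (d3.sub d5).mono (show _ ≤ N by omega)
    have d7 := (d4.sub d5).mono (show _ ≤ N by omega)
    replace d3 := d3.mono (show _ ≤ N by omega)
    replace d4 := d4.mono (show _ ≤ N by omega)
    replace d5 := d5.mono (show _ ≤ N by omega)
    have d8 := (combo_priceNum K c).mono (show _ ≤ N by omega)
    have d9 := hnat (K.wt i) (by omega)
    have d10 := hnat (K.priceDen c) (by omega)
    refine .seq (achieves_setPosPart ?_ ?_ hz (achieves_setPosPart ?_ ?_ hz ?_))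
    · simp [NExpr.Within, NExpr.eval, hv]; omega
    · simp [RExpr.Within, NExpr.Within, NExpr.eval, RExpr.eval, hv, hw, hup, ha', hb', d1, d3, d5, d6, d8, d9, d10]; omega
    · simp [NExpr.Within, NExpr.eval, hv]; omega
    · simp [RExpr.Within, NExpr.Within, NExpr.eval, RExpr.eval, hv, hw, hpr, ha', hb', d2, d4, d5, d7, d8, d9, d10]; omega
    · intro x hx
      rcases Nat.lt_succ_iff_lt_or_eq.1 hx with h | rfl
      · simp [NExpr.eval, hv, h.ne, hI x h]
      · simp [NExpr.eval, RExpr.eval, hv, hw, hup, hpr, ha', hb', Instance.upSurplus,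
          Instance.prSurplus]

open Classical in
/-- The bound `dual c S`, restricted to the items below `i`. -/
noncomputable def partialDual (K : Instance) (c : ℕ) (S : Finset ℕ) (i : ℕ) : ℝ :=
  K.priceNum c * K.capacity +
    ∑ x ∈ range i, if x ∈ S then K.prSurplus c x else K.upSurplus c x

theorem partialDual_succ_of_mem {c i : ℕ} {S : Finset ℕ} (h : i ∈ S) :
    partialDual K c S (i + 1) = partialDual K c S i + K.prSurplus c i := by
  rw [partialDual, sum_range_succ, if_pos h, ← add_assoc, partialDual]

theorem partialDual_succ_of_notMem {c i : ℕ} {S : Finset ℕ} (h : i ∉ S) :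
    partialDual K c S (i + 1) = partialDual K c S i + K.upSurplus c i := by
  rw [partialDual, sum_range_succ, if_neg h, ← add_assoc, partialDual]

theorem combo_partialDual (K : Instance) (c : ℕ) (S : Finset ℕ) (i : ℕ) :
    Combo K ((K.capacity + 1) + i * (2 * (K.capacity + 1))) (partialDual K c S i) := by
  classical
  refine (combo_priceNum_mul K c le_rfl).add ?_
  have := Combo.sum (K := K) (k := 2 * (K.capacity + 1)) (s := range i)
    (f := fun x => if x ∈ S then K.prSurplus c x else K.upSurplus c x) fun x _ => by
      split_ifs
      · exact combo_prSurplus K c x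
      · exact combo_upSurplus K c x
  rwa [card_range] at this

theorem front_succ {g : ℕ → ℝ} {i j : ℕ} :
    (Before g i j → (front g (i + 1) j).card = (front g i j).card + 1) ∧
    (¬ Before g i j → (front g (i + 1) j).card = (front g i j).card) := by
  classical
  unfold front
  rw [range_add_one]
  refine ⟨fun h => ?_, fun h => ?_⟩
  · rw [filter_insert, if_pos h, card_insert_of_notMem (by simp)]
  · rw [filter_insert, if_neg h]

/-- The surpluses for price `c` are stored. -/
def HasSurpluses (K : Instance) (c : ℕ) (m : Memory) : Prop :=
  m.real 4 0 = K.priceNum c ∧ m.nat 11 0 = K.priceDen c ∧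
    ∀ i < K.n, m.real 5 i = K.upSurplus c i ∧ m.real 6 i = K.prSurplus c i

theorem HasSurpluses.of_sameOutside {p : Program} {c : ℕ} {m' : Memory}
    (h : HasSurpluses K c m) (hs : SameOutside p m m') (hn : 11 ∉ p.natTargets)
    (hr : 4 ∉ p.realTargets ∧ 5 ∉ p.realTargets ∧ 6 ∉ p.realTargets) : HasSurpluses K c m' := by
  unfold HasSurpluses
  rw [hs.1 11 hn, hs.2 4 hr.1, hs.2 5 hr.2.1, hs.2 6 hr.2.2]
  exact h

open Classical in
theorem achieves_scanPrefix {c j : ℕ} (hm : Reads K m) (hS : HasSurpluses K c m)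
    (hj : m.nat 12 0 = j) (hjn : j < K.n) :
    Achieves (rangeBound K) (Combo K (rangeBound K)) scanPrefix m fun m' =>
      m'.nat 13 0 = (K.prefixSet c j).card ∧ m'.real 7 0 = K.dual c (K.prefixSet c j) ∧
      ∀ i < K.n, m'.nat 15 i = if i ∈ K.prefixSet c j then 1 else 0 := by
  set N := rangeBound K with hNdef
  have hN := rangeBound_eq K
  rw [← hNdef] at hN
  have hnm := n_le_mul K
  obtain ⟨hn, hB, hw, hlo, hup, hpr⟩ := hm
  have hnat : ∀ a ≤ N, Combo K N a := fun a h => (Combo.natCast a).mono h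
  refine .seq (.setNat (Nat.zero_le _) (Nat.zero_le _) (.seq (.setReal (Nat.zero_le _) ?_ ?_)))
  · have d1 := (combo_priceNum K c).mono (show 1 ≤ N by omega)
    have d2 := hnat K.capacity (by omega)
    have d3 := (combo_priceNum_mul K c le_rfl).mono (show _ ≤ N by omega)
    simp [RExpr.Within, NExpr.Within, NExpr.eval, RExpr.eval, hS.1, hB, d1, d2, d3]
    omega
  set m1 := (m.writeNat 13 (NExpr.eval m (.lit 0)) (NExpr.eval m (.lit 0))).writeReal 7
    (NExpr.eval (m.writeNat 13 (NExpr.eval m (.lit 0)) (NExpr.eval m (.lit 0))) (.lit 0))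
    (RExpr.eval (m.writeNat 13 (NExpr.eval m (.lit 0)) (NExpr.eval m (.lit 0)))
      (.mul (.get 4 (.lit 0)) (.ofNat cap))) with hm1def
  have h1n : ∀ a, a ≠ 13 → m1.nat a = m.nat a := fun a h => m.nat_writeNat_ne _ _ _ h
  have h1r : ∀ a, a ≠ 7 → m1.real a = m.real a := fun a h => Memory.real_writeReal_ne _ _ _ _ h
  have hm1 : Reads K m1 := by
    refine ⟨?_, ?_, ?_, ?_, ?_, ?_⟩
    · rw [h1n 0 (by decide), hn]
    · rw [h1n 0 (by decide), hB]
    · rw [h1n 1 (by decide), hw]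
    · rw [h1r 0 (by decide), hlo]
    · rw [h1r 1 (by decide), hup]
    · rw [h1r 2 (by decide), hpr]
  have hS1 : HasSurpluses K c m1 := by
    unfold HasSurpluses
    rw [h1n 11 (by decide), h1r 4 (by decide), h1r 5 (by decide), h1r 6 (by decide)]
    exact hS
  have hj1 : m1.nat 12 0 = j := by rw [h1n 12 (by decide), hj]
  have h13 : m1.nat 13 0 = 0 := by simp [m1, NExpr.eval]
  have h7 : m1.real 7 0 = K.priceNum c * K.capacity := by
    simp [m1, NExpr.eval, RExpr.eval, hS.1, hB]
  clear_value m1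
  -- The comparison item `j` stays fixed while the range of scanned items grows, so at the end the
  -- count is that of the full prefix.
  refine .forLoop (n := K.n) (fun i m' => m'.nat 13 0 = (front (K.gain c) i j).card ∧
    m'.real 7 0 = partialDual K c (K.prefixSet c j) i ∧
    ∀ x < i, m'.nat 15 x = if x ∈ K.prefixSet c j then 1 else 0) (by omega) (by decide)
    (fun m' hs => (hm1.of_sameOutside hs (by decide) (by decide)).numItems) ?_ ?_ ?_
  · simp [front, partialDual, h13, h7]
  · rintro i hi m' hs hv ⟨h13, h7, h15⟩
    obtain ⟨hn, hB, hw, hlo, hup, hpr⟩ := hm1.of_sameOutside hs (by decide) (by decide)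
    obtain ⟨ha, hb, hX⟩ := hS1.of_sameOutside hs (by decide) (by decide)
    have hj' : m'.nat 12 0 = j := by rw [hs.1 12 (by decide), hj1]
    obtain ⟨xi, yi⟩ := hX i hi
    obtain ⟨xj, yj⟩ := hX j hjn
    have hmem : i ∈ K.prefixSet c j ↔ Before (K.gain c) i j := by
      simp [Instance.prefixSet, mem_front, hi]
    have hcard : (front (K.gain c) i j).card ≤ i := by
      simpa using card_le_card (front_subset (K.gain c) i j)
    -- Each scanned item adds coefficient sum `2 * (K.capacity + 1)`, so even the last partial bound
    -- stays within `rangeBound`.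
    have hmul : i * (2 * (K.capacity + 1)) + 2 * (K.capacity + 1) ≤
        2 * (K.n * (K.capacity + 1)) := by
      have := Nat.mul_le_mul_right (K.capacity + 1) (Nat.succ_le_of_lt hi)
      rw [Nat.succ_mul] at this
      rw [Nat.mul_left_comm]
      omega
    have d0 := combo_partialDual K c (K.prefixSet c j) i
    have d1 := (d0.add (combo_upSurplus K c i)).mono (show _ ≤ N by omega)
    have d2 := (d0.add (combo_prSurplus K c i)).mono (show _ ≤ N by omega)
    replace d0 := d0.mono (show _ ≤ N by omega)
    have d3 := fun i => (combo_upSurplus K c i).mono (show _ ≤ N by omega)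
    have d4 := fun i => (combo_prSurplus K c i).mono (show _ ≤ N by omega)
    have d5 := fun i => ((combo_upSurplus K c i).sub (combo_prSurplus K c i)).mono
      (show _ ≤ N by omega)
    refine .ite ?_ (fun h => ?_) fun h => ?_
    · simp [BExpr.or, BExpr.Within, RExpr.Within, NExpr.Within, NExpr.eval, RExpr.eval, hv, hj', xi,
        yi, xj, yj, d3, d4, d5]
      omega
    · have hbef : Before (K.gain c) i j := by
        simpa [BExpr.Holds, NExpr.eval, RExpr.eval, hv, hj', xi, yi, xj, yj, Before,
          Instance.gain, lt_sub_iff_add_lt] using h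
      refine .seq (.setNat ?_ ?_ (.seq (.setNat (Nat.zero_le _) ?_
        (.setReal (Nat.zero_le _) ?_ ?_))))
      · simp [NExpr.Within, NExpr.eval, hv]; omega
      · simp only [NExpr.Within]; omega
      · simp [NExpr.Within, NExpr.eval, h13]; omega
      · simp [RExpr.Within, NExpr.Within, NExpr.eval, RExpr.eval, hv, h7, yi, d0, d2, d4]; omega
      · refine ⟨?_, ?_, fun x hx => ?_⟩
        · simp [NExpr.eval, h13, front_succ.1 hbef]
        · simp [NExpr.eval, RExpr.eval, hv, h7, yi, partialDual_succ_of_mem (hmem.2 hbef)]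
        · rcases Nat.lt_succ_iff_lt_or_eq.1 hx with h | rfl
          · simp [NExpr.eval, hv, h.ne, h15 x h]
          · simp [NExpr.eval, hv, hmem, hbef]
    · have hbef : ¬ Before (K.gain c) i j := by
        intro hbef
        refine h ?_
        simpa [BExpr.Holds, NExpr.eval, RExpr.eval, hv, hj', xi, yi, xj, yj, Before,
          Instance.gain, lt_sub_iff_add_lt] using hbef
      refine .seq (.setNat ?_ (Nat.zero_le _) (.setReal (Nat.zero_le _) ?_ ?_))
      · simp [NExpr.Within, NExpr.eval, hv]; omega
      · simp [RExpr.Within, NExpr.Within, NExpr.eval, RExpr.eval, hv, h7, xi, d0, d1, d3]; omega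
      · refine ⟨?_, ?_, fun x hx => ?_⟩
        · simp [h13, front_succ.2 hbef]
        · simp [NExpr.eval, RExpr.eval, hv, h7, xi,
            partialDual_succ_of_notMem (fun h => hbef (hmem.1 h))]
        · rcases Nat.lt_succ_iff_lt_or_eq.1 hx with h | rfl
          · simp [NExpr.eval, hv, h.ne, h15 x h]
          · simp [NExpr.eval, hv, hmem, hbef]
  · rintro m' - ⟨h13, h7, h15⟩
    exact ⟨h13, h7, h15⟩

open Classical in
/-- Integer array `14` holds a smallest set found by trying the pairs in `T`. -/
def Keeps (K : Instance) (T : ℕ → ℕ → Prop) (m : Memory) : Prop :=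
  ∃ S, K.Selected T S ∧ m.nat 9 0 = S.card ∧ ∀ i < K.n, m.nat 14 i = if i ∈ S then 1 else 0

theorem Keeps.congr {T T' : ℕ → ℕ → Prop} {m' : Memory} (h : Keeps K T m)
    (h9 : m'.nat 9 = m.nat 9) (h14 : m'.nat 14 = m.nat 14) (hT : ∀ c j, T' c j → T c j) :
    Keeps K T' m' := by
  obtain ⟨S, ⟨h1, h2, h3⟩, h4, h5⟩ := h
  exact ⟨S, ⟨h1, h2, fun c j h => h3 c j (hT c j h)⟩, by rw [h9, h4], by rwa [h14]⟩

open Classical in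
theorem achieves_keepSmaller {c j : ℕ} {T : ℕ → ℕ → Prop} (hm : Reads K m)
    (hV : m.real 3 (K.n * (K.capacity + 1) + K.capacity) = K.opt)
    (hb : m.nat 11 0 = K.priceDen c) (h13 : m.nat 13 0 = (K.prefixSet c j).card)
    (h7 : m.real 7 0 = K.dual c (K.prefixSet c j))
    (h15 : ∀ i < K.n, m.nat 15 i = if i ∈ K.prefixSet c j then 1 else 0) (hk : Keeps K T m) :
    Achieves (rangeBound K) (Combo K (rangeBound K)) keepSmaller m
      (Keeps K fun c' j' => T c' j' ∨ (c' = c ∧ j' = j)) := by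
  set N := rangeBound K with hNdef
  have hN := rangeBound_eq K
  rw [← hNdef] at hN
  have hnm := n_le_mul K
  obtain ⟨S, ⟨hSn, hSp, hST⟩, h9, h14⟩ := hk
  have hm0 := hm
  obtain ⟨hn, hB, hw, hlo, hup, hpr⟩ := hm
  have hnat : ∀ a ≤ N, Combo K N a := fun a h => (Combo.natCast a).mono h
  have hden := priceDen_le K c
  have hSc : S.card ≤ K.n := by simpa using card_le_card hSn
  have hpn : K.prefixSet c j ⊆ range K.n := front_subset _ _ _
  have hpc : (K.prefixSet c j).card ≤ K.n := by simpa using card_le_card hpn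
  refine .ite ?_ (fun h => ?_) fun h => .skip ?_
  · have d0 := combo_partialDual K c (K.prefixSet c j) K.n
    have e0 : K.n * (2 * (K.capacity + 1)) = 2 * (K.n * (K.capacity + 1)) := Nat.mul_left_comm ..
    have d1 : Combo K N (K.dual c (K.prefixSet c j)) := d0.mono (show _ ≤ N by omega)
    have d2 : Combo K K.n K.opt := combo_best K _ _
    have e1 : 2 * K.priceDen c * K.n ≤ 2 * (K.n * (K.capacity + 1)) := by
      rw [mul_assoc, mul_comm K.n]; gcongr
    have d3 := (d2.natMul (2 * K.priceDen c)).mono (show _ ≤ N by omega)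
    have d4 := hnat (2 * K.priceDen c) (by omega)
    replace d2 := d2.mono (show _ ≤ N by omega)
    push_cast at d3 d4
    simp [BExpr.Within, RExpr.Within, NExpr.Within, NExpr.eval, RExpr.eval, hb, hn, hB, hV, h7, h9,
      h13, d1, d2, d3, d4]
    omega
  · have h' : 1 ≤ K.priceDen c ∧ K.dual c (K.prefixSet c j) ≤ 2 * K.priceDen c * K.opt ∧
        (K.prefixSet c j).card < S.card := by
      simpa [BExpr.Holds, NExpr.eval, RExpr.eval, hb, hn, hB, hV, h7, h9, h13] using h
    have hpass : K.Passes c j := ⟨h'.1, h'.2.1⟩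
    refine .seq (.setNat (Nat.zero_le _) ?_ ?_)
    · simp [NExpr.Within, NExpr.eval, h13]; omega
    have e9 : m.writeNat 9 (NExpr.eval m (.lit 0)) (NExpr.eval m (nvar 13)) =
      m.writeNat 9 0 (K.prefixSet c j).card := by simp [NExpr.eval, h13]
    rw [e9]
    set m1 := m.writeNat 9 0 (K.prefixSet c j).card with hm1def
    have h1n : ∀ a, a ≠ 9 → m1.nat a = m.nat a := fun a h => m.nat_writeNat_ne _ _ _ h
    have hm1 : Reads K m1 := by
      refine ⟨?_, ?_, ?_, hlo, hup, hpr⟩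
      · rw [h1n 0 (by decide), hn]
      · rw [h1n 0 (by decide), hB]
      · rw [h1n 1 (by decide), hw]
    refine .forLoop (n := K.n) (fun i m' => ∀ x < i, m'.nat 14 x =
      if x ∈ K.prefixSet c j then 1 else 0) (by omega) (by decide)
      (fun m' hs => (hm1.of_sameOutside hs (by decide) (by decide)).numItems) (by simp) ?_ ?_
    · intro i hi m' hs hv hI
      have h15' : m'.nat 15 i = if i ∈ K.prefixSet c j then 1 else 0 := by
        rw [hs.1 15 (by decide), h1n 15 (by decide), h15 i hi]
      refine .setNat ?_ ?_ fun x hx => ?_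
      · simp [NExpr.Within, NExpr.eval, hv]; omega
      · simp only [NExpr.Within, NExpr.eval, hv, h15']
        refine ⟨⟨Nat.zero_le _, by omega⟩, ?_⟩
        split_ifs <;> omega
      · rcases Nat.lt_succ_iff_lt_or_eq.1 hx with h | rfl
        · simp [NExpr.eval, hv, h.ne, hI x h]
        · simp [NExpr.eval, hv, h15']
    · intro m' hs hI
      refine ⟨K.prefixSet c j, ⟨hpn, .inr ⟨c, j, hpass, rfl⟩, ?_⟩, ?_, hI⟩
      · rintro c' j' (h | ⟨rfl, rfl⟩) hp
        · exact h'.2.2.le.trans (hST c' j' h hp)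
        · exact le_rfl
      · rw [hs.1 9 (by decide)]; simp [m1]
  · refine ⟨S, ⟨hSn, hSp, ?_⟩, h9, h14⟩
    rintro c' j' (h1 | ⟨rfl, rfl⟩) hp
    · exact hST c' j' h1 hp
    -- The test can only have failed for a pair that does not pass or whose prefix is no smaller
    -- than the stored set.
    · by_contra! hlt
      refine h ?_
      simpa [BExpr.Holds, NExpr.eval, RExpr.eval, hb, hn, hB, hV, h7, h9, h13] using
        ⟨hp.1, hp.2, hlt⟩

theorem achieves_selectPrefix (hm : Reads K m)
    (hV : m.real 3 (K.n * (K.capacity + 1) + K.capacity) = K.opt) :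
    Achieves (rangeBound K) (Combo K (rangeBound K)) selectPrefix m
      (Keeps K fun c j => c < 2 * K.n + 1 ∧ j < K.n) := by
  classical
  have hN := rangeBound_eq K
  have hnm := n_le_mul K
  refine .seq (.setNat (Nat.zero_le _) hm.numItems.1 (.seq ?_))
  rw [hm.numItems.2]
  set m1 := m.writeNat 9 (NExpr.eval m (.lit 0)) K.n with hm1def
  have h1n : ∀ a, a ≠ 9 → m1.nat a = m.nat a := fun a h => m.nat_writeNat_ne _ _ _ h
  have hm1 : Reads K m1 := by
    obtain ⟨hn, hB, hw, hlo, hup, hpr⟩ := hm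
    refine ⟨?_, ?_, ?_, hlo, hup, hpr⟩
    · rw [h1n 0 (by decide), hn]
    · rw [h1n 0 (by decide), hB]
    · rw [h1n 1 (by decide), hw]
  have h19 : m1.nat 9 0 = K.n := by simp [m1, NExpr.eval]
  have hV1 : m1.real 3 (K.n * (K.capacity + 1) + K.capacity) = K.opt := hV
  refine .forLoop (n := K.n) (fun i m' => ∀ x < i, m'.nat 14 x = 1) (by omega) (by decide)
    (fun m' hs => (hm1.of_sameOutside hs (by decide) (by decide)).numItems) (by simp) ?_ ?_
  · intro i hi m' hs hv hI
    refine .setNat ?_ ?_ fun x hx => ?_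
    · simp [NExpr.Within, NExpr.eval, hv]; omega
    · simp only [NExpr.Within]; omega
    · rcases Nat.lt_succ_iff_lt_or_eq.1 hx with h | rfl
      · simp [NExpr.eval, hv, h.ne, hI x h]
      · simp [NExpr.eval, hv]
  · intro m2 hs2 h14
    have hm2 := hm1.of_sameOutside hs2 (by decide) (by decide)
    have hV2 : m2.real 3 (K.n * (K.capacity + 1) + K.capacity) = K.opt := by
      rw [hs2.2 3 (by decide), hV1]
    -- Before any price is tried, the set of all items serves as the fallback.
    have hk2 : Keeps K (fun c j => c < 0 ∧ j < K.n) m2 := by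
      refine ⟨range K.n, ⟨subset_rfl, .inl rfl, fun c j h => by omega⟩, ?_, fun i hi => ?_⟩
      · rw [hs2.1 9 (by decide), h19, card_range]
      · rw [h14 i hi, if_pos (mem_range.2 hi)]
    refine .forLoop (n := 2 * K.n + 1) (fun c m' => Keeps K (fun c' j => c' < c ∧ j < K.n) m')
      (by omega) (by decide) (fun m' hs => ?_) ?_ (fun c hc m' hs hv hk => ?_) fun _ _ h => h
    · have := hm2.of_sameOutside hs (by decide) (by decide)
      simp [NExpr.Within, NExpr.eval, this.1]
      omega
    · exact hk2.congr (Memory.nat_writeNat_ne _ _ _ _ (by decide))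
        (Memory.nat_writeNat_ne _ _ _ _ (by decide)) fun _ _ h => h
    · have hm' := hm2.of_sameOutside hs (by decide) (by decide)
      have hV' : m'.real 3 (K.n * (K.capacity + 1) + K.capacity) = K.opt := by
        rw [hs.2 3 (by decide), hV2]
      refine .seq ((achieves_setPrice hm' hv hc).mono fun m₃ hs₃ ⟨ha₃, hb₃⟩ => .seq ?_)
      have hm₃ := hm'.of_sameOutside hs₃ (by decide) (by decide)
      refine (achieves_setSurpluses hm₃ ha₃ hb₃).mono fun m₄ hs₄ hX => ?_
      have hm₄ := hm₃.of_sameOutside hs₄ (by decide) (by decide)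
      have hS₄ : HasSurpluses K c m₄ :=
        ⟨by rw [hs₄.2 4 (by decide), ha₃], by rw [hs₄.1 11 (by decide), hb₃], hX⟩
      have hV₄ : m₄.real 3 (K.n * (K.capacity + 1) + K.capacity) = K.opt := by
        rw [hs₄.2 3 (by decide), hs₃.2 3 (by decide), hV']
      have hk₄ : Keeps K (fun c' j => c' < c ∧ j < K.n) m₄ := hk.congr
        (by rw [hs₄.1 9 (by decide), hs₃.1 9 (by decide)])
        (by rw [hs₄.1 14 (by decide), hs₃.1 14 (by decide)]) fun _ _ h => h
      refine .forLoop (n := K.n) (fun j m' => Keeps K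
        (fun c' j' => (c' < c ∧ j' < K.n) ∨ (c' = c ∧ j' < j)) m') (by omega) (by decide)
        (fun m' hs => (hm₄.of_sameOutside hs (by decide) (by decide)).numItems) ?_
        (fun j hj m₅ hs₅ hv₅ hk₅ => ?_) fun m₅ _ hk₅ => ?_
      · exact hk₄.congr (Memory.nat_writeNat_ne _ _ _ _ (by decide))
          (Memory.nat_writeNat_ne _ _ _ _ (by decide)) fun _ _ h => by omega
      · have hm₅ := hm₄.of_sameOutside hs₅ (by decide) (by decide)
        have hS₅ := hS₄.of_sameOutside hs₅ (by decide) (by decide)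
        refine .seq ((achieves_scanPrefix hm₅ hS₅ hv₅ hj).mono fun m₆ hs₆ ⟨h13, h7, h15⟩ => ?_)
        refine (achieves_keepSmaller (hm₅.of_sameOutside hs₆ (by decide) (by decide))
          (by rw [hs₆.2 3 (by decide), hs₅.2 3 (by decide), hV₄])
          (by rw [hs₆.1 11 (by decide), hS₅.2.1]) h13 h7 h15
          (hk₅.congr (hs₆.1 9 (by decide)) (hs₆.1 14 (by decide)) fun _ _ h => h)).mono
          fun m₇ _ hk₇ => ?_
        exact hk₇.congr (Memory.nat_writeNat_ne _ _ _ _ (by decide))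
          (Memory.nat_writeNat_ne _ _ _ _ (by decide)) fun _ _ h => by omega
      · exact hk₅.congr (Memory.nat_writeNat_ne _ _ _ _ (by decide))
          (Memory.nat_writeNat_ne _ _ _ _ (by decide)) fun _ _ h => by omega

theorem achieves_mergeOutput (hm : Reads K m) (h14 : ∀ i < K.n, m.nat 14 i ≤ 1) :
    Achieves (rangeBound K) (Combo K (rangeBound K)) mergeOutput m fun m' =>
      ∀ i < K.n, m'.nat 2 i ≠ 0 ↔ m.nat 2 i ≠ 0 ∨ m.nat 14 i = 1 := by
  have hN := rangeBound_eq K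
  have hnm := n_le_mul K
  -- The second clause records that entries not yet visited still hold the marks of the packing.
  refine .forLoop (n := K.n) (fun i m' => (∀ x < i, m'.nat 2 x ≠ 0 ↔ m.nat 2 x ≠ 0 ∨
    m.nat 14 x = 1) ∧ ∀ x, i ≤ x → m'.nat 2 x = m.nat 2 x) (by omega) (by decide)
    (fun m' hs => (hm.of_sameOutside hs (by decide) (by decide)).numItems) (by simp)
    (fun i hi m' hs hv hI => ?_) fun m' _ h => h.1
  have h14' : m'.nat 14 i = m.nat 14 i := by rw [hs.1 14 (by decide)]
  have hle := h14 i hi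
  refine .ite ?_ (fun h => .setNat ?_ ?_ ⟨fun x hx => ?_, fun x hx => ?_⟩)
    fun h => .skip ⟨fun x hx => ?_, fun x hx => ?_⟩
  · simp [BExpr.Within, NExpr.Within, NExpr.eval, hv, h14']; omega
  · simp [NExpr.Within, NExpr.eval, hv]; omega
  · simp only [NExpr.Within]; omega
  · have h1 : m.nat 14 i = 1 := by
      have : 1 ≤ m.nat 14 i := by simpa [BExpr.Holds, NExpr.eval, hv, h14'] using h
      omega
    rcases Nat.lt_succ_iff_lt_or_eq.1 hx with h | rfl
    · simpa [NExpr.eval, hv, h.ne] using hI.1 x h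
    · simp [NExpr.eval, hv, h1]
  · simpa [NExpr.eval, hv, show x ≠ i by omega] using hI.2 x (by omega)
  · have h1 : m.nat 14 i ≠ 1 := by
      have : ¬ 1 ≤ m.nat 14 i := by simpa [BExpr.Holds, NExpr.eval, hv, h14'] using h
      omega
    rcases Nat.lt_succ_iff_lt_or_eq.1 hx with h | rfl
    · simpa using hI.1 x h
    · simp [hI.2 x le_rfl, h1]
  · simpa using hI.2 x (by omega)

theorem achieves_knapsackProgram (K : Instance) {ε : ℝ} (hε0 : 0 < ε) :
    Achieves (rangeBound K) (Combo K (rangeBound K)) knapsackProgram K.input fun m =>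
      K.IsApproxFeasible (1 / (1 - ε)) ((1 + ε) * 2) (K.output m) ∧
        (K.output m).card ≤ 2 * K.minQueries := by
  classical
  have hm := reads_input K
  have e : (K.n + 1) * (K.capacity + 1) = K.n * (K.capacity + 1) + (K.capacity + 1) := by ring
  refine .seq ((achieves_fillTable hm (by ext; simp [Instance.input])
    (by simp [Instance.input])).mono fun m₁ hs₁ hT₁ => ?_)
  have hm₁ := hm.of_sameOutside hs₁ (by decide) (by decide)
  have h₁ : ∀ x, m₁.nat 2 x = 0 := fun x => by
    rw [hs₁.1 2 (by decide)]; simp [Instance.input]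
  refine .seq ((achieves_markPacking hm₁ hT₁ h₁).mono fun m₂ hs₂ h₂ => ?_)
  have hm₂ := hm₁.of_sameOutside hs₂ (by decide) (by decide)
  have hV₂ : m₂.real 3 (K.n * (K.capacity + 1) + K.capacity) = K.opt := by
    rw [hs₂.2 3 (by decide), (hT₁ K.n K.capacity le_rfl (by omega)).1, Instance.opt]
  refine .seq ((achieves_selectPrefix hm₂ hV₂).mono fun m₃ hs₃ ⟨S, hS, _, h14⟩ => ?_)
  have hm₃ := hm₂.of_sameOutside hs₃ (by decide) (by decide)
  refine (achieves_mergeOutput hm₃ fun i hi => by rw [h14 i hi]; split_ifs <;> simp).mono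
    fun m₄ _ h₄ => Instance.good_of_selected hS (fun i => ?_) hε0
  rw [Instance.output, mem_filter, h₄ i i.2, hs₃.1 2 (by decide), h₂, h14 i i.2]
  have := queryCost_le K i
  by_cases h : (i : ℕ) ∈ K.optPacking <;> by_cases h' : (i : ℕ) ∈ S <;> simp [h, h']
  omega

end Stages

-- With `X` standing for input length plus capacity, `rangeBound` is at most `8 * (X + 1) ^ 2`; the
-- first factor bounds the number of operations and the second the cost of each. The final memory in
-- `Achieves` is fixed before the length function, so one output serves both cost models.
open Polynomial in
theorem computes_knapsackProgram {ε : ℝ} (hε0 : 0 < ε) :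
    ComputesInPseudoPolyTime knapsackProgram fun K Q =>
      K.IsApproxFeasible (1 / (1 - ε)) ((1 + ε) * 2) Q ∧ Q.card ≤ 2 * K.minQueries := by
  refine ⟨knapsackProgram.stepPoly.comp (8 * (X + 1) ^ 2) * (8 * (X + 1) ^ 2 + 3 * X + 3), fun K => ?_⟩
  obtain ⟨m, hrun, hgood⟩ := achieves_knapsackProgram K hε0
  have key : ∀ sz, Fits (rangeBound K) (Combo K (rangeBound K)) sz
      (rangeBound K + 3 * K.inputLength sz + 2) → ∃ t, Runs sz knapsackProgram K.input m t ∧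
      t ≤ (knapsackProgram.stepPoly.comp (8 * (X + 1) ^ 2) *
        (8 * (X + 1) ^ 2 + 3 * X + 3)).eval (K.inputLength sz + K.capacity) := by
    intro sz hfit
    obtain ⟨t, ht, hle⟩ := hrun sz _ hfit
    have hn := K.n_le_inputLength sz
    have hN : rangeBound K ≤ 8 * (K.inputLength sz + K.capacity + 1) ^ 2 := by
      rw [rangeBound, sq]
      gcongr <;> omega
    refine ⟨t, ht, hle.trans ?_⟩
    simp only [eval_mul, eval_comp, eval_add, eval_pow, eval_X, eval_one, eval_ofNat]
    exact Nat.mul_le_mul (Program.stepPoly_mono _ hN) (by omega)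
  refine ⟨m, hgood, key _ ?_, fun hK => key _ (K.fits_bitSize hK _)⟩
  obtain ⟨h1, h2⟩ := fits_unitSize (rangeBound K) (Combo K (rangeBound K))
  exact ⟨fun v hv => (h1 v hv).trans (by omega), fun x hx => (h2 x hx).trans (by omega)⟩

end KnapExp

theorem mainTheorem3 (ε : ℝ) (hε0 : 0 < ε) (hε1 : ε < 1) :
    ∃ c : KnapExp.Program, KnapExp.ComputesInPseudoPolyTime c fun K Q =>
      K.IsApproxFeasible (1 / (1 - ε)) ((1 + ε) * 2) Q ∧ Q.card ≤ 2 * K.minQueries :=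
  ⟨KnapExp.knapsackProgram, KnapExp.computes_knapsackProgram hε0⟩
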